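/- **Setting.** Let $f:\mathbb R^n\to\mathbb R$ be twice continuously differentiable and bounded below, with $f_{\inf}=\inf f$, $g=\nabla f$, $H=\nabla^2 f$. Let $x_0\in\mathbb R^n$ and $\mathcal L=\{x: f(x)\le f(x_0)\}$. Suppose that on some open convex set $\mathcal L^+\supseteq\mathcal L$ the maps $g$ and $H$ are bounded (by $M_1,M_2>0$) and Lipschitz continuous (with constants $L_1,L_2>0$), in the Euclidean and spectral norms. Write $\lambda(M)$ for the smallest eigenvalue of a symmetric matrix $M$, $(a)_-=\max\{0,-a\}$, and $\log^+t=\max\{0,\log t\}$ with $\log^+0=0$. **Regions.** For $\kappa\in(0,\min\{L_1,L_2\}]$ put $\Delta(x)=f(x)-f_{\inf}$ and $$\mathcal R_1=\{x\in\mathcal L:\|g(x)\|^\tau\ge\kappa\Delta(x)\ge0\text{ for some }\tau\in[1,2]\},$$ $$\mathcal R_2=\{x\in\mathcal L\setminus\mathcal R_1:(\lambda(H(x)))_-^\tau\ge\kappa\Delta(x)\ge0\text{ for some }\tau\in[1,3]\}.$$ $\mathcal R_1^2$ is the set of $x\in\mathcal R_1$ for which $\tau=2$ works, and $\mathcal R_1^1=\mathcal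 R_1\setminus\mathcal R_1^2$. $\mathcal R_2^3$ is the set of $x\in\mathcal R_2$ for which $\tau=3$ works, $\mathcal R_2^2$ is the set of $x\in\mathcal R_2\setminus\mathcal R_2^3$ for which $\tau=2$ works, and $\mathcal R_2^1=\mathcal R_2\setminus(\mathcal R_2^2\cup\mathcal R_2^3)$. **Methods.** Let $x_k$ be the iterates, $g_k=g(x_k)$, $H_k=H(x_k)$, $q_k(s)=g_k^Ts+\frac12s^TH_ks$. * RN, with parameter $l_2>L_2/2$: $x_{k+1}=x_k+s_k$, where $s_k$ is a global minimizer of $q_k(s)+\frac{l_2}{3}\|s\|^3$. Put $\nu_k=l_2$. * RN-A and TR-H, with parameters $\eta\in(0,1)$, $\psi>1$, $0<\nu_{\min}\le\nu_{\max}$. In RN-A the trial step $s_k$ is a global minimizer of $m_k(s)=q_k(s)+\frac{\nu_k}{3}\|s\|^3$. In TR-H it is a global minimizer of $m_k(s)=q_k(s)$ subject to $\|s\|\le\delta_k$, where $\delta_k=\|g_k\|/\nu_k$ if $\|g_k\|^2\ge(\lambda(H_k))_-^3$ and $\delta_k=(\lambda(H_k))_- /\nu_k$ otherwise. If $f(x_k)-f(x_k+s_k)\ge-\eta\,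 m_k(s_k)$, the step is accepted: $x_{k+1}=x_k+s_k$ and $\nu_{k+1}$ is any element of $[\nu_{\min},\nu_{\max}]$. Otherwise it is rejected: $x_{k+1}=x_k$ and $\nu_{k+1}=\psi\nu_k$. Initially $\nu_0$ is any element of $[\nu_{\min},\nu_{\max}]$. **Theorem.** Let one of TR-H, RN, RN-A be given. There are a threshold $\zeta_0$ and an integer $m\ge1$, depending only on $L_1$, $L_2$, the method and its parameters, such that for every $\zeta\ge\max\{\zeta_0,L_1,L_2\}$, every $\kappa\in(0,\min\{L_1,L_2\}]$ and every $D$ there is a constant $C>0$, depending in addition only on $\kappa,\zeta,D$, such that the following holds for all $n$, $f$, $x_0$ as above. If $f$ is $(g,H)$-dominated of degree $(1,1)$ with constant $\kappa$, i.e. $\max\{\|g(x)\|,(\lambda(H(x)))_-\}\ge\kappa(f(x)-f_{\inf})$ for all $x\in\mathcal L$, then $\mathcal L=\mathcal R_1\cup\mathcal R_2$. Suppose that $\mathcal L=\mathcal R_1\cup\mathcal R_2$ and $f(x_0)-f_{\inf}\le D$, and consider any run of the method from $x_0$. Write $\Delta_k=f(x_k)-f_{\inf}$, $\mathcal K(\epsilon_f)=\{k:\Delta_k>\epsilon_f\}$,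 $\omega=\kappa^3/\zeta^4$, and $\xi=1-\kappa/\zeta$ for TR-H, respectively $$\xi=\max\Big\{1-\frac\kappa\zeta,\ \frac{\Delta_0^{1/4}}{\kappa^{3/4}/\zeta+\Delta_0^{1/4}}\Big\}\quad\text{for RN and RN-A.}$$ Then $\xi\in(0,1)$. For every $\epsilon_f>0$ there is a smallest $\bar k$ with $\Delta_{\bar k}<\max\{1/\kappa,\epsilon_f\}$, and $\Delta_{k+m}\le\xi\Delta_k$ for all $k<\bar k$. If $\epsilon_f<1/\kappa$, then at least one of cases (c) and (d) below occurs ((a) and (b) are special cases of (c)), and the following statements hold. In (a)–(c), $\hat k$ is the smallest index $\ge\bar k$ such that $x_k$ lies in the stated set for all $k\ge\hat k$. Each bound on $|\mathcal K(\epsilon_f)|$ includes that this set is finite. (a) If $x_k\in\mathcal R_1^2\cup\mathcal R_2^3$ for all $k\ge\hat k$, then $\Delta_{k+m}\le\xi\Delta_k$ for all $k\ge\hat k$ and $|\mathcal K(\epsilon_f)|\le(\hat k-\bar k)+C\,(1+\log^+(\Delta_0/\epsilon_f))$. For RN and RN-A, if moreover $x_k\in\mathcal R_1^2$ for all $k\ge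 K$, then $\Delta_k<\omega$ for all large $k$; for all $k\ge K$ with $\Delta_k<\omega$ and $\Delta_{k+m}>0$, $$0<\tfrac43\log\frac{\omega}{\Delta_k}\le\log\frac{\omega}{\Delta_{k+m}};$$ and if $\epsilon_f<\omega$, then $|\mathcal K(\epsilon_f)|\le K+C\,(1+\log^+(\Delta_0/\omega))+C\,(1+\log^+\log(\omega/\epsilon_f))$. Furthermore, if a subsequence of $(x_k)$ converges to a point $x_*$ with $g(x_*)=0$ and $\lambda(H(x_*))>0$ and, for TR-H, $\nu_k\le\lambda(H(x_*))$ for all large $k$, then $x_k\to x_*$ and $\|x_{k+1}-x_*\|\le c\|x_k-x_*\|^2$ for some $c$ and all large $k$. (b) If $x_k\in\mathcal R_1^2\cup\mathcal R_2^2\cup\mathcal R_2^3$ for all $k\ge\hat k$, then for all $j\in\mathbb N$ $$\Delta_{\hat k+jm}\le\Big(1+j\,\tfrac{\kappa^{3/2}}{\zeta}\,\tfrac{\sqrt2-1}{\sqrt2}\sqrt{\Delta_{\hat k}}\Big)^{-2}\Delta_{\hat k},\qquad(1)$$ $$|\mathcal K(\epsilon_f)|\le(\hat k-\bar k)+C\log^+\frac{\Delta_0}{1/\kappa}+C\,\frac{1/\kappa}{\sqrt{\epsilon_f}}.\qquad(2)$$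 (c) If $x_k\in\mathcal R_1^1\cup\mathcal R_1^2\cup\mathcal R_2^2\cup\mathcal R_2^3$ for all $k\ge\hat k$, then for RN and RN-A (1) and (2) hold, and for TR-H, for all $j\in\mathbb N$, $$\Delta_{\hat k+jm}\le\Big(1+j\,\tfrac{\kappa^2}{\zeta}\Delta_{\hat k}\Big)^{-1}\Delta_{\hat k},\qquad|\mathcal K(\epsilon_f)|\le(\hat k-\bar k)+C\log^+\frac{\Delta_0}{1/\kappa}+C\,\frac{1/\kappa}{\epsilon_f}.$$ (d) If $x_k\in\mathcal R_2^1$ for infinitely many $k$, then for each of the three methods and all $j\in\mathbb N$ $$\Delta_{\bar k+jm}\le\Big(1+j\,\tfrac{\kappa^3}{\zeta}\Delta_{\bar k}^2\Big)^{-1/2}\Delta_{\bar k},\qquad|\mathcal K(\epsilon_f)|\le C\log^+\frac{\Delta_0}{1/\kappa}+C\,\frac{1/\kappa}{\epsilon_f^2}.$$ -/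

import Mathlib

open Filter Topology Set
open scoped RealInnerProductSpace

noncomputable section

namespace RegionalComplexity

/-- Euclidean space of dimension `n`. -/
abbrev E (n : ℕ) : Type := EuclideanSpace ℝ (Fin n)

/-- The sublevel set of `f` determined by the initial point `x₀`. -/
def levelSet {n : ℕ} (f : E n → ℝ) (x₀ : E n) : Set (E n) := {y | f y ≤ f x₀}

/-- The infimum of `f` (used only for functions that are bounded below). -/
def fInf {n : ℕ} (f : E n → ℝ) : ℝ := ⨅ y, f y

/-- The Hessian of `f` at `y`, as the derivative of the gradient; its operator norm is the
spectral norm of the Hessian matrix. -/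
def hess {n : ℕ} (f : E n → ℝ) (y : E n) : E n →L[ℝ] E n := fderiv ℝ (gradient f) y

/-- The left-most (smallest) real eigenvalue of an operator. -/
def leftEig {n : ℕ} (A : E n →L[ℝ] E n) : ℝ :=
  sInf {μ : ℝ | Module.End.HasEigenvalue (A : E n →ₗ[ℝ] E n) μ}

/-- The quantity `(λ(H(y)))₋ = max {0, -λ(H(y))}`. -/
def negCurv {n : ℕ} (f : E n → ℝ) (y : E n) : ℝ := max 0 (-(leftEig (hess f y)))

/-- The standing assumptions: `f` is twice continuously differentiable and bounded below, and on
an open convex set `Lp` containing the initial sublevel set the gradient and the Hessian are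
bounded (by `M₁`, `M₂`) and Lipschitz continuous (with constants `L₁`, `L₂`). -/
structure StandingAssumptions {n : ℕ} (f : E n → ℝ) (x₀ : E n) (Lp : Set (E n))
    (L₁ L₂ M₁ M₂ : ℝ) : Prop where
  smooth : ContDiff ℝ 2 f
  bddBelow : BddBelow (range f)
  isOpen : IsOpen Lp
  convex : Convex ℝ Lp
  subset : levelSet f x₀ ⊆ Lp
  L₁_pos : 0 < L₁
  L₂_pos : 0 < L₂
  M₁_pos : 0 < M₁
  M₂_pos : 0 < M₂
  grad_bound : ∀ y ∈ Lp, ‖gradient f y‖ ≤ M₁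
  grad_lipschitz : ∀ y ∈ Lp, ∀ z ∈ Lp, ‖gradient f y - gradient f z‖ ≤ L₁ * ‖y - z‖
  hess_bound : ∀ y ∈ Lp, ‖hess f y‖ ≤ M₂
  hess_lipschitz : ∀ y ∈ Lp, ∀ z ∈ Lp, ‖hess f y - hess f z‖ ≤ L₂ * ‖y - z‖

section Regions

variable {n : ℕ} (f : E n → ℝ) (x₀ : E n) (κ fRef : ℝ)

/-- Region `R₁`: gradient-dominated points of the initial sublevel set. -/
def region1 : Set (E n) :=
  {y | y ∈ levelSet f x₀ ∧ ∃ τ ∈ Icc (1 : ℝ) 2,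
    κ * (f y - fRef) ≤ ‖gradient f y‖ ^ τ ∧ 0 ≤ κ * (f y - fRef)}

/-- Subregion `R₁²`. -/
def region12 : Set (E n) :=
  {y | y ∈ region1 f x₀ κ fRef ∧ κ * (f y - fRef) ≤ ‖gradient f y‖ ^ (2 : ℝ)}

/-- Subregion `R₁¹`. -/
def region11 : Set (E n) := region1 f x₀ κ fRef \ region12 f x₀ κ fRef

/-- Region `R₂`: points outside `R₁` that are dominated by negative curvature. -/
def region2 : Set (E n) :=
  {y | y ∈ levelSet f x₀ \ region1 f x₀ κ fRef ∧ ∃ τ ∈ Icc (1 : ℝ) 3,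
    κ * (f y - fRef) ≤ negCurv f y ^ τ ∧ 0 ≤ κ * (f y - fRef)}

/-- Subregion `R₂³`. -/
def region23 : Set (E n) :=
  {y | y ∈ region2 f x₀ κ fRef ∧ κ * (f y - fRef) ≤ negCurv f y ^ (3 : ℝ)}

/-- Subregion `R₂²`. -/
def region22 : Set (E n) :=
  {y | y ∈ region2 f x₀ κ fRef \ region23 f x₀ κ fRef ∧
    κ * (f y - fRef) ≤ negCurv f y ^ (2 : ℝ)}

/-- Subregion `R₂¹`. -/
def region21 : Set (E n) :=
  region2 f x₀ κ fRef \ (region22 f x₀ κ fRef ∪ region23 f x₀ κ fRef)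

/-- `f` is `(g,H)`-dominated of degree `(τ₁, τ₂)` over the sublevel set, with constant `κ`. -/
def IsGHDominated (τ₁ τ₂ : ℝ) : Prop :=
  ∀ y ∈ levelSet f x₀,
    κ * (f y - fInf f) ≤ max (‖gradient f y‖ ^ τ₁) (negCurv f y ^ τ₂)

end Regions

section Algorithms

variable {n : ℕ} (f : E n → ℝ)

/-- Increment of the second-order Taylor model at `y`: `gᵀs + ½ sᵀHs`. -/
def quadInc (y s : E n) : ℝ := ⟪gradient f y, s⟫ + 1 / 2 * ⟪s, hess f y s⟫

/-- Increment of the cubically regularized model at `y`: `gᵀs + ½ sᵀHs + (ν/3) ‖s‖³`. -/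
def cubicInc (ν : ℝ) (y s : E n) : ℝ := quadInc f y s + ν / 3 * ‖s‖ ^ 3

/-- `s` is a global solution of the trust-region subproblem at `y` with radius `δ`. -/
def IsTRStep (δ : ℝ) (y s : E n) : Prop :=
  ‖s‖ ≤ δ ∧ ∀ t : E n, ‖t‖ ≤ δ → quadInc f y s ≤ quadInc f y t

/-- `s` is a global minimizer of the cubically regularized model at `y`. -/
def IsCubicStep (ν : ℝ) (y s : E n) : Prop := ∀ t : E n, cubicInc f ν y s ≤ cubicInc f ν y t

open Classical in
/-- The trust-region radius of `TR-H`. -/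
def trHRadius (ν : ℝ) (y : E n) : ℝ :=
  1 / ν * (if negCurv f y ^ 3 ≤ ‖gradient f y‖ ^ 2 then ‖gradient f y‖ else negCurv f y)

/-- Acceptance/rejection of trial steps and update of the parameters `ν k`, where `pred k` is the
reduction predicted by the model at iteration `k`: the trial step `s k` is accepted if the actual
reduction is at least `η * pred k`; initially and after an accepted step the parameter is any
element of `[νmin, νmax]`; after a rejected step it is multiplied by `ψ`. -/
def AdaptiveUpdate (η ψ νmin νmax : ℝ) (pred : ℕ → ℝ) (x s : ℕ → E n) (ν : ℕ → ℝ) : Prop :=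
  ν 0 ∈ Icc νmin νmax ∧ ∀ k,
    (η * pred k ≤ f (x k) - f (x k + s k) → x (k + 1) = x k + s k ∧ ν (k + 1) ∈ Icc νmin νmax) ∧
    (¬ η * pred k ≤ f (x k) - f (x k + s k) → x (k + 1) = x k ∧ ν (k + 1) = ψ * ν k)

/-- The three second-order methods with their parameters: the adaptive trust-region method `TR-H`,
the static regularized Newton method `RN`, the adaptive regularized Newton method `RN-A`. -/
inductive Method : Type
  | trH (η ψ νmin νmax : ℝ) : Method
  | rn (l₂ : ℝ) : Method
  | rnA (η ψ νmin νmax : ℝ) : Method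

/-- The method is `TR-H`. -/
def Method.IsTRH : Method → Prop
  | .trH _ _ _ _ => True
  | .rn _ => False
  | .rnA _ _ _ _ => False

/-- The parameters are in the ranges that the methods prescribe (`L₂` is the Lipschitz constant of
the Hessian). -/
def Method.Admissible (L₂ : ℝ) : Method → Prop
  | .trH η ψ νmin νmax => 0 < η ∧ η < 1 ∧ 1 < ψ ∧ 0 < νmin ∧ νmin ≤ νmax
  | .rn l₂ => L₂ / 2 < l₂
  | .rnA η ψ νmin νmax => 0 < η ∧ η < 1 ∧ 1 < ψ ∧ 0 < νmin ∧ νmin ≤ νmax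

/-- `x`, `s`, `ν` are the iterates, trial steps and regularization parameters of a run of the
method on `f` (for `RN` every step is taken and `ν k` is the fixed parameter `l₂`). -/
def Method.IsRun (x s : ℕ → E n) (ν : ℕ → ℝ) : Method → Prop
  | .trH η ψ νmin νmax =>
      (∀ k, IsTRStep f (trHRadius f (ν k) (x k)) (x k) (s k)) ∧
      AdaptiveUpdate f η ψ νmin νmax (fun k => -quadInc f (x k) (s k)) x s ν
  | .rn l₂ =>
      ∀ k, ν k = l₂ ∧ IsCubicStep f l₂ (x k) (s k) ∧ x (k + 1) = x k + s k
  | .rnA η ψ νmin νmax =>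
      (∀ k, IsCubicStep f (ν k) (x k) (s k)) ∧
      AdaptiveUpdate f η ψ νmin νmax (fun k => -cubicInc f (ν k) (x k) (s k)) x s ν

/-- The linear rate constant `ξ`, in terms of the initial gap `Δ₀`. -/
def Method.xi (κ ζ Δ₀ : ℝ) : Method → ℝ
  | .trH _ _ _ _ => 1 - κ / ζ
  | .rn _ => max (1 - κ / ζ)
      (Δ₀ ^ (1 / 4 : ℝ) / (κ ^ (3 / 4 : ℝ) / ζ + Δ₀ ^ (1 / 4 : ℝ)))
  | .rnA _ _ _ _ => max (1 - κ / ζ)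
      (Δ₀ ^ (1 / 4 : ℝ) / (κ ^ (3 / 4 : ℝ) / ζ + Δ₀ ^ (1 / 4 : ℝ)))

end Algorithms

/-- The set `K_f(ε)` of the iterations at which the gap exceeds `ε`. -/
def Kf {n : ℕ} (f : E n → ℝ) (x : ℕ → E n) (ε : ℝ) : Set ℕ := {k | ε < f (x k) - fInf f}

/-- `K_f(ε)` is finite and has at most `b` elements. -/
def CardLE {n : ℕ} (f : E n → ℝ) (x : ℕ → E n) (ε b : ℝ) : Prop :=
  (Kf f x ε).Finite ∧ ((Kf f x ε).ncard : ℝ) ≤ b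

/-- `khat` is the smallest index that is at least `kbar` and from which on all iterates are
in `S`. -/
def SettlesAt {n : ℕ} (x : ℕ → E n) (S : Set (E n)) (kbar khat : ℕ) : Prop :=
  IsLeast {K : ℕ | kbar ≤ K ∧ ∀ k, K ≤ k → x k ∈ S} khat

/-- The sequence `x` converges to `xs`, ultimately at a quadratic rate. -/
def ConvergesQuadratically {n : ℕ} (x : ℕ → E n) (xs : E n) : Prop :=
  Tendsto x atTop (𝓝 xs) ∧
    ∃ c : ℝ, ∀ᶠ k in atTop, ‖x (k + 1) - xs‖ ≤ c * ‖x k - xs‖ ^ 2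

end RegionalComplexity

end

namespace RegionalComplexity

/-! ### Symmetry of the Hessian and calculus along segments. -/

section Taylor

variable {n : ℕ} {f : E n → ℝ}

/-! All three methods obey one estimate, recorded in `Progress` and proved in
`Method.exists_progress`. For every `k` there is an iterate `x p` with `k ≤ p ≤ k + m` at which both
`‖g‖ ^ θ` and `negCurv ^ 3` are at most `Z * (f (x k) - f (x (k + m)))`, where `θ = 2` for TR-H and
`θ = 3 / 2` for RN and RN-A. For TR-H, `x p` is the point an accepted step leaves, and comparison
with a gradient step and a negative curvature step bounds the measures there. For the cubic models
it is the point reached, since the optimality conditions control the new gradient by `‖s‖ ^ 2`.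
Rejections cost only a bounded number of iterations, because large `ν` forces acceptance.

The regions bound `κ * Δ` at `x p` by powers of the same measures, and the gap is nonincreasing.
Hence `(κ * Δ (k + m)) ^ q ≤ Z * (Δ k - Δ (k + m))`, up to a constant, with a power `q` fixed by the
region and the method. All rates come from this scalar recursion: `q = 1` is linear, `q = 3 / 4` is
linear with a rate depending on the initial gap and eventually superlinear of order `4 / 3`, and `q
= 3 / 2, 2, 3` give gaps of order `j ^ (-2)`, `j ^ (-1)`, `j ^ (-1 / 2)`. While `κ * Δ ≥ 1` the
unknown exponent `τ` can be traded for `2` or `3` at the price of a factor, which gives the initial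
linear phase. Once `κ * Δ < 1` it can be traded for `1`.

Quadratic convergence is a separate local argument: near a minimizer with positive definite Hessian
every trial step is accepted and nearly solves the Newton equation. -/

theorem contDiff_gradient (hf : ContDiff ℝ 2 f) : ContDiff ℝ 1 (gradient f) := by
  have h1 : ContDiff ℝ 1 (fderiv ℝ f) := hf.fderiv_right (by norm_num)
  exact (InnerProductSpace.toDual ℝ (E n)).symm.contDiff.comp h1

theorem hasFDerivAt_gradient (hf : ContDiff ℝ 2 f) (y : E n) :
    HasFDerivAt (gradient f) (hess f y) y :=
  ((contDiff_gradient hf).differentiable (by norm_num) y).hasFDerivAt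

/-- The derivative of `z ↦ fderiv ℝ f z w`, which is also `z ↦ ⟪w, gradient f z⟫`, is computed in
two ways. Uniqueness identifies `hess` with the second Fréchet derivative, whose symmetry makes the
Hessian self-adjoint. -/
theorem inner_hess (hf : ContDiff ℝ 2 f) (y v w : E n) :
    ⟪hess f y v, w⟫ = fderiv ℝ (fderiv ℝ f) y v w := by
  have h1 : ContDiff ℝ 1 (fderiv ℝ f) := hf.fderiv_right (by norm_num)
  have h2 : HasFDerivAt (fderiv ℝ f) (fderiv ℝ (fderiv ℝ f) y) y :=
    (h1.differentiable (by norm_num) y).hasFDerivAt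
  have h3 : HasFDerivAt (fun z => fderiv ℝ f z w)
      ((ContinuousLinearMap.apply ℝ ℝ w).comp (fderiv ℝ (fderiv ℝ f) y)) y :=
    (ContinuousLinearMap.apply ℝ ℝ w).hasFDerivAt.comp y h2
  have h4 : HasFDerivAt (fun z => fderiv ℝ f z w) ((innerSL ℝ w).comp (hess f y)) y := by
    have := (innerSL ℝ w).hasFDerivAt.comp y (hasFDerivAt_gradient hf y)
    refine this.congr_of_eventuallyEq (Eventually.of_forall fun z => ?_)
    simp only [Function.comp_apply, innerSL_apply_apply]
    rw [real_inner_comm, inner_gradient_left]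
  have h5 := congrArg (fun A : E n →L[ℝ] ℝ => A v) (h4.unique h3)
  simp only [ContinuousLinearMap.comp_apply, innerSL_apply_apply,
    ContinuousLinearMap.apply_apply] at h5
  rwa [real_inner_comm] at h5

theorem inner_hess_comm (hf : ContDiff ℝ 2 f) (y v w : E n) :
    ⟪hess f y v, w⟫ = ⟪v, hess f y w⟫ := by
  rw [real_inner_comm (hess f y w) v, inner_hess hf, inner_hess hf]
  exact (hf.contDiffAt.isSymmSndFDerivAt (by simp)).eq v w

theorem isSymmetric_hess (hf : ContDiff ℝ 2 f) (y : E n) :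
    ((hess f y : E n →L[ℝ] E n) : E n →ₗ[ℝ] E n).IsSymmetric :=
  fun v w => inner_hess_comm hf y v w

theorem hasDerivAt_line (x s : E n) (t : ℝ) : HasDerivAt (fun t : ℝ => x + t • s) s t := by
  simpa using ((hasDerivAt_id t).smul_const s).const_add x

theorem hasDerivAt_comp_line (hf : ContDiff ℝ 2 f) (x s : E n) (t : ℝ) :
    HasDerivAt (fun t : ℝ => f (x + t • s)) ⟪gradient f (x + t • s), s⟫ t := by
  have h1 : HasFDerivAt f (fderiv ℝ f (x + t • s)) (x + t • s) :=
    (hf.differentiable (by norm_num) _).hasFDerivAt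
  have := h1.comp_hasDerivAt t (hasDerivAt_line x s t)
  rwa [← inner_gradient_left] at this

theorem hasDerivAt_gradient_line (hf : ContDiff ℝ 2 f) (x s : E n) (t : ℝ) :
    HasDerivAt (fun t : ℝ => gradient f (x + t • s)) (hess f (x + t • s) s) t :=
  HasFDerivAt.comp_hasDerivAt (l := gradient f) t (hasFDerivAt_gradient hf (x + t • s))
    (hasDerivAt_line x s t)

/-- A curve on `[0, 1]` that starts at `0` and whose speed is at most `c (p + 1) t ^ p` ends within
distance `c` of `0`. -/
theorem norm_le_of_norm_deriv_le_pow {F : Type*} [NormedAddCommGroup F] [NormedSpace ℝ F]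
    {φ φ' : ℝ → F} {c : ℝ} {p : ℕ} (h0 : φ 0 = 0)
    (hd : ∀ t, HasDerivAt φ (φ' t) t)
    (hb : ∀ t ∈ Ico (0 : ℝ) 1, ‖φ' t‖ ≤ c * ((p + 1 : ℝ) * t ^ p)) {t : ℝ}
    (ht : t ∈ Icc (0 : ℝ) 1) : ‖φ t‖ ≤ c * t ^ (p + 1) := by
  have := image_norm_le_of_norm_deriv_right_le_deriv_boundary (f := φ) (f' := φ') (a := 0) (b := 1)
    (B := fun t => c * t ^ (p + 1)) (B' := fun t => c * ((p + 1 : ℝ) * t ^ p))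
    (fun t _ => (hd t).continuousAt.continuousWithinAt) (fun t _ => (hd t).hasDerivWithinAt)
    (by simp [h0]) (fun t => by
      have := (hasDerivAt_pow (p + 1) t).const_mul c
      simpa using this) (fun t ht => hb t ht)
  exact this ht

end Taylor

/-! ### Taylor estimates on the convex neighbourhood of the sublevel set. -/

section Standing

variable {n : ℕ} {f : E n → ℝ} {x₀ : E n} {Lp : Set (E n)} {L₁ L₂ M₁ M₂ : ℝ}

theorem StandingAssumptions.fInf_le (h : StandingAssumptions f x₀ Lp L₁ L₂ M₁ M₂) (y : E n) :
    fInf f ≤ f y := ciInf_le h.bddBelow y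

theorem StandingAssumptions.line_mem (h : StandingAssumptions f x₀ Lp L₁ L₂ M₁ M₂) {x s : E n}
    (hx : x ∈ Lp) (hs : x + s ∈ Lp) {t : ℝ} (ht : t ∈ Icc (0 : ℝ) 1) : x + t • s ∈ Lp := by
  have := h.convex hx hs (sub_nonneg.2 ht.2) ht.1 (by ring)
  convert this using 1
  module

/-- The derivative of a map that is Lipschitz near a point is bounded there by the Lipschitz
constant. Curvature bounds can thus be expressed through `L₁`. -/
theorem StandingAssumptions.norm_hess_le (h : StandingAssumptions f x₀ Lp L₁ L₂ M₁ M₂) {y : E n}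
    (hy : y ∈ Lp) : ‖hess f y‖ ≤ L₁ := by
  have := norm_fderiv_le_of_lipschitzOn (𝕜 := ℝ) (f := gradient f) (C := ⟨L₁, h.L₁_pos.le⟩)
    (h.isOpen.mem_nhds hy) (LipschitzOnWith.of_dist_le_mul fun a ha b hb => by
      rw [dist_eq_norm, dist_eq_norm]; exact h.grad_lipschitz a ha b hb)
  exact this

theorem StandingAssumptions.inner_hess_le (h : StandingAssumptions f x₀ Lp L₁ L₂ M₁ M₂) {y : E n}
    (hy : y ∈ Lp) (s : E n) : |⟪s, hess f y s⟫| ≤ L₁ * ‖s‖ ^ 2 := by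
  calc |⟪s, hess f y s⟫| ≤ ‖s‖ * ‖hess f y s‖ := abs_real_inner_le_norm _ _
    _ ≤ ‖s‖ * (L₁ * ‖s‖) := by
        gcongr
        exact (hess f y).le_of_opNorm_le (h.norm_hess_le hy) s
    _ = L₁ * ‖s‖ ^ 2 := by ring

theorem StandingAssumptions.gradient_taylor_line (h : StandingAssumptions f x₀ Lp L₁ L₂ M₁ M₂)
    {x s : E n} (hx : x ∈ Lp) (hs : x + s ∈ Lp) {t : ℝ} (ht : t ∈ Icc (0 : ℝ) 1) :
    ‖gradient f (x + t • s) - gradient f x - t • hess f x s‖ ≤ L₂ / 2 * ‖s‖ ^ 2 * t ^ 2 := by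
  refine norm_le_of_norm_deriv_le_pow (p := 1)
    (φ := fun t => gradient f (x + t • s) - gradient f x - t • hess f x s)
    (φ' := fun t => hess f (x + t • s) s - hess f x s) (by simp) (fun t => ?_)
    (fun t ht => ?_) ht
  · have := ((hasDerivAt_gradient_line h.smooth x s t).sub_const (gradient f x)).fun_sub
      ((hasDerivAt_id t).smul_const (hess f x s))
    simpa using this
  · have hm := h.line_mem hx hs ⟨ht.1, ht.2.le⟩
    have h1 := h.hess_lipschitz _ hm _ hx
    rw [add_sub_cancel_left, norm_smul, Real.norm_of_nonneg ht.1] at h1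
    rw [← sub_apply]
    calc _ ≤ (L₂ * (t * ‖s‖)) * ‖s‖ := ContinuousLinearMap.le_of_opNorm_le _ h1 s
      _ = _ := by push_cast; ring

theorem StandingAssumptions.gradient_taylor (h : StandingAssumptions f x₀ Lp L₁ L₂ M₁ M₂)
    {x s : E n} (hx : x ∈ Lp) (hs : x + s ∈ Lp) :
    ‖gradient f (x + s) - gradient f x - hess f x s‖ ≤ L₂ / 2 * ‖s‖ ^ 2 := by
  simpa using h.gradient_taylor_line hx hs (t := 1) (by simp)

theorem StandingAssumptions.taylor_two (h : StandingAssumptions f x₀ Lp L₁ L₂ M₁ M₂)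
    {x s : E n} (hx : x ∈ Lp) (hs : x + s ∈ Lp) :
    |f (x + s) - f x - quadInc f x s| ≤ L₂ / 6 * ‖s‖ ^ 3 := by
  have := norm_le_of_norm_deriv_le_pow (p := 2) (c := L₂ / 6 * ‖s‖ ^ 3)
    (φ := fun t : ℝ => f (x + t • s) - f x - (t * ⟪gradient f x, s⟫ +
      t ^ 2 * (1 / 2 * ⟪s, hess f x s⟫)))
    (φ' := fun t : ℝ => ⟪gradient f (x + t • s) - gradient f x - t • hess f x s, s⟫)
    (by simp) (fun t => ?_) (fun t ht => ?_) (t := 1) (by simp)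
  · simpa [quadInc] using this
  · have := ((hasDerivAt_comp_line h.smooth x s t).sub_const (f x)).fun_sub
      (((hasDerivAt_id' t).mul_const ⟪gradient f x, s⟫).fun_add
        ((hasDerivAt_pow 2 t).mul_const (1 / 2 * ⟪s, hess f x s⟫)))
    convert this using 1
    rw [inner_sub_left, inner_sub_left, real_inner_smul_left, real_inner_comm s (hess f x s)]
    simp
    ring
  · calc _ ≤ ‖gradient f (x + t • s) - gradient f x - t • hess f x s‖ * ‖s‖ :=
          norm_inner_le_norm _ _
      _ ≤ (L₂ / 2 * ‖s‖ ^ 2 * t ^ 2) * ‖s‖ := by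
          gcongr
          exact h.gradient_taylor_line hx hs ⟨ht.1, ht.2.le⟩
      _ = _ := by push_cast; ring

theorem StandingAssumptions.taylor_one (h : StandingAssumptions f x₀ Lp L₁ L₂ M₁ M₂)
    {x s : E n} (hx : x ∈ Lp) (hs : x + s ∈ Lp) :
    |f (x + s) - f x - ⟪gradient f x, s⟫| ≤ L₁ / 2 * ‖s‖ ^ 2 := by
  have := norm_le_of_norm_deriv_le_pow (p := 1) (c := L₁ / 2 * ‖s‖ ^ 2)
    (φ := fun t : ℝ => f (x + t • s) - f x - t * ⟪gradient f x, s⟫)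
    (φ' := fun t : ℝ => ⟪gradient f (x + t • s) - gradient f x, s⟫)
    (by simp) (fun t => ?_) (fun t ht => ?_) (t := 1) (by simp)
  · simpa using this
  · have := ((hasDerivAt_comp_line h.smooth x s t).sub_const (f x)).fun_sub
      ((hasDerivAt_id' t).mul_const ⟪gradient f x, s⟫)
    convert this using 1
    rw [inner_sub_left]
    simp
  · have hm := h.line_mem hx hs ⟨ht.1, ht.2.le⟩
    have h1 := h.grad_lipschitz _ hm _ hx
    rw [add_sub_cancel_left, norm_smul, Real.norm_of_nonneg ht.1] at h1
    calc _ ≤ ‖gradient f (x + t • s) - gradient f x‖ * ‖s‖ := norm_inner_le_norm _ _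
      _ ≤ (L₁ * (t * ‖s‖)) * ‖s‖ := by gcongr
      _ = _ := by push_cast; ring

theorem StandingAssumptions.continuous (h : StandingAssumptions f x₀ Lp L₁ L₂ M₁ M₂) :
    Continuous f := h.smooth.continuous

/-- If `f` does not exceed `f x` at any point of the segment from `x` to `x + s` that belongs to
`Lp`, then the whole segment belongs to `Lp`. -/
theorem StandingAssumptions.segment_subset (h : StandingAssumptions f x₀ Lp L₁ L₂ M₁ M₂)
    {x s : E n} (hx : x ∈ levelSet f x₀)
    (hd : ∀ t ∈ Icc (0 : ℝ) 1, x + t • s ∈ Lp → f (x + t • s) ≤ f x) : x + s ∈ Lp := by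
  have hc : Continuous fun t : ℝ => x + t • s := by fun_prop
  -- Continuity argument: the set of good `t` is closed, and at a good `t` the point lies in the
  -- sublevel set, hence in the open set `Lp`. Nearby points are then in `Lp` as well, where `hd`
  -- makes them good.
  have hsub : Icc (0 : ℝ) 1 ⊆ {t | t ∈ Icc (0 : ℝ) 1 ∧ f (x + t • s) ≤ f x} := by
    apply IsClosed.Icc_subset_of_forall_mem_nhdsWithin
    · refine IsClosed.inter ?_ isClosed_Icc
      exact isClosed_Icc.inter (isClosed_le (h.continuous.comp hc) continuous_const)
    · simp
    · rintro t ⟨⟨_, h2⟩, h3⟩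
      have hm : x + t • s ∈ Lp := h.subset (h2.trans hx)
      have h4 : ∀ᶠ u in 𝓝 t, x + u • s ∈ Lp :=
        hc.continuousAt.eventually (h.isOpen.mem_nhds hm)
      have h5 : ∀ᶠ u in 𝓝[>] t, u ∈ Icc (0 : ℝ) 1 := by
        have := Ioc_mem_nhdsGT h3.2
        filter_upwards [this] with u hu
        exact ⟨h3.1.trans hu.1.le, hu.2⟩
      filter_upwards [h4.filter_mono nhdsWithin_le_nhds, h5] with u hu1 hu2
      exact ⟨hu2, hd u hu2 hu1⟩
  have h1 := (hsub (right_mem_Icc.2 zero_le_one)).2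
  rw [one_smul] at h1
  exact h.subset (h1.trans hx)

end Standing

/-! ### The smallest eigenvalue and the Rayleigh quotient. -/

section LeftEig

variable {n : ℕ} {A : E n →L[ℝ] E n}

/-- In positive finite dimension the infimum of the Rayleigh quotient of a symmetric operator is an
eigenvalue. The eigenvalues form a finite set, so their infimum is attained and lies below every
Rayleigh quotient. -/
theorem isLeast_leftEig (hA : (A : E n →ₗ[ℝ] E n).IsSymmetric) (hn : 0 < n) :
    IsLeast {μ : ℝ | Module.End.HasEigenvalue (A : E n →ₗ[ℝ] E n) μ} (leftEig A) ∧
      ∀ v, leftEig A * ‖v‖ ^ 2 ≤ ⟪v, A v⟫ := by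
  have : Nontrivial (E n) := by
    have : Nonempty (Fin n) := ⟨⟨0, hn⟩⟩
    infer_instance
  set S := {μ : ℝ | Module.End.HasEigenvalue (A : E n →ₗ[ℝ] E n) μ}
  have hfin : S.Finite := Module.End.finite_hasEigenvalue _
  have h1 := hA.hasEigenvalue_iInf_of_finiteDimensional
  set q : ℝ := ⨅ x : { x : E n // x ≠ 0 },
    RCLike.re ⟪(A : E n →ₗ[ℝ] E n) x, x⟫ / ‖(x : E n)‖ ^ 2 with hq
  have hS : q ∈ S := h1
  have hl : IsLeast S (leftEig A) := ⟨Set.Nonempty.csInf_mem ⟨q, hS⟩ hfin,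
    fun μ hμ => csInf_le hfin.bddBelow hμ⟩
  refine ⟨hl, fun v => ?_⟩
  by_cases hv : v = 0
  · simp [hv]
  have hb : BddBelow (range fun x : { x : E n // x ≠ 0 } =>
      RCLike.re ⟪(A : E n →ₗ[ℝ] E n) x, x⟫ / ‖(x : E n)‖ ^ 2) := by
    refine ⟨-‖A‖, ?_⟩
    rintro _ ⟨x, rfl⟩
    have := (abs_le.1 (A.rayleighQuotient_le_norm x)).1
    exact this
  have h2 := ciInf_le hb ⟨v, hv⟩
  have hv' : 0 < ‖v‖ ^ 2 := by positivity
  have h3 : leftEig A ≤ RCLike.re ⟪(A : E n →ₗ[ℝ] E n) v, v⟫ / ‖v‖ ^ 2 := (hl.2 hS).trans h2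
  rw [le_div_iff₀ hv', real_inner_comm] at h3
  exact h3

theorem leftEig_mul_le (hA : (A : E n →ₗ[ℝ] E n).IsSymmetric) (v : E n) :
    leftEig A * ‖v‖ ^ 2 ≤ ⟪v, A v⟫ := by
  rcases Nat.eq_zero_or_pos n with rfl | hn
  · simp [Subsingleton.elim v 0]
  · exact (isLeast_leftEig hA hn).2 v

/-- In dimension zero there are no eigenvalues, and `sInf ∅ = 0`. -/
theorem pos_of_leftEig_ne_zero (h : leftEig A ≠ 0) : 0 < n := by
  rcases Nat.eq_zero_or_pos n with rfl | hn
  · exfalso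
    apply h
    have : {μ : ℝ | Module.End.HasEigenvalue (A : E 0 →ₗ[ℝ] E 0) μ} = ∅ := by
      ext μ
      simp only [mem_ofPred_eq, mem_empty_iff_false, iff_false]
      intro hμ
      obtain ⟨v, hv⟩ := hμ.exists_hasEigenvector
      exact hv.2 (Subsingleton.elim _ _)
    rw [leftEig, this, Real.sInf_empty]
  · exact hn

theorem exists_unit_eigenvector (hA : (A : E n →ₗ[ℝ] E n).IsSymmetric) (h : leftEig A ≠ 0) :
    ∃ v : E n, ‖v‖ = 1 ∧ A v = leftEig A • v := by
  obtain ⟨v, hv⟩ := Module.End.HasEigenvalue.exists_hasEigenvector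
    (isLeast_leftEig hA (pos_of_leftEig_ne_zero h)).1.1
  have hv0 : ‖v‖ ≠ 0 := norm_ne_zero_iff.2 hv.2
  refine ⟨‖v‖⁻¹ • v, by rw [norm_smul, norm_inv, norm_norm, inv_mul_cancel₀ hv0], ?_⟩
  have : A v = leftEig A • v := hv.apply_eq_smul
  rw [map_smul, this, smul_comm]

end LeftEig

/-! ### Negative curvature. -/

section NegCurv

variable {n : ℕ} {f : E n → ℝ} {x₀ : E n} {Lp : Set (E n)} {L₁ L₂ M₁ M₂ : ℝ}

theorem negCurv_nonneg (f : E n → ℝ) (y : E n) : 0 ≤ negCurv f y := le_max_left _ _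

theorem neg_negCurv_le (hf : ContDiff ℝ 2 f) (y v : E n) :
    -negCurv f y * ‖v‖ ^ 2 ≤ ⟪v, hess f y v⟫ := by
  refine le_trans ?_ (leftEig_mul_le (isSymmetric_hess hf y) v)
  gcongr
  linarith [le_max_right 0 (-(leftEig (hess f y))), show negCurv f y = max 0 _ from rfl]

/-- A direction of most negative curvature, along which `f` does not increase to first order. -/
theorem exists_negCurv_direction (hf : ContDiff ℝ 2 f) {y : E n} (h : 0 < negCurv f y) :
    ∃ v : E n, ‖v‖ = 1 ∧ ⟪gradient f y, v⟫ ≤ 0 ∧ ⟪v, hess f y v⟫ = -negCurv f y := by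
  have h1 : leftEig (hess f y) < 0 := by
    by_contra h2
    push Not at h2
    simp [negCurv, h2] at h
  obtain ⟨v, hv, hA⟩ := exists_unit_eigenvector (isSymmetric_hess hf y) h1.ne
  have h3 : ⟪v, hess f y v⟫ = -negCurv f y := by
    rw [hA, real_inner_smul_right, real_inner_self_eq_norm_sq, hv, negCurv,
      max_eq_right (by linarith)]
    ring
  rcases le_total ⟪gradient f y, v⟫ 0 with h4 | h4
  · exact ⟨v, hv, h4, h3⟩
  · refine ⟨-v, by simpa using hv, by simpa using h4, by simpa using h3⟩

/-- The most negative direction at `y` is tested in the quadratic form at `x`. The estimate carries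
the curvature bound of a cubic step from the old point to the new one. -/
theorem StandingAssumptions.negCurv_le_add (h : StandingAssumptions f x₀ Lp L₁ L₂ M₁ M₂)
    {x y : E n} (hx : x ∈ Lp) (hy : y ∈ Lp) : negCurv f y ≤ negCurv f x + L₂ * ‖y - x‖ := by
  rcases (negCurv_nonneg f y).eq_or_lt with h0 | h0
  · rw [← h0]
    have := negCurv_nonneg f x
    have := h.L₂_pos
    positivity
  obtain ⟨v, hv, -, hvy⟩ := exists_negCurv_direction h.smooth h0
  have h1 := neg_negCurv_le h.smooth x v
  have h2 : |⟪v, (hess f y - hess f x) v⟫| ≤ L₂ * ‖y - x‖ := by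
    calc _ ≤ ‖v‖ * ‖(hess f y - hess f x) v‖ := abs_real_inner_le_norm _ _
      _ ≤ 1 * (L₂ * ‖y - x‖ * 1) := by
        rw [← hv]
        gcongr
        exact ContinuousLinearMap.le_of_opNorm_le _ (h.hess_lipschitz y hy x hx) v
      _ = _ := by ring
  rw [sub_apply, inner_sub_right, hvy] at h2
  rw [hv] at h1
  linarith [(abs_le.1 h2).1]

end NegCurv

/-! ### The quadratic model and its error. -/

section Models

variable {n : ℕ} {f : E n → ℝ}

theorem quadInc_zero (f : E n → ℝ) (y : E n) : quadInc f y 0 = 0 := by simp [quadInc]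

theorem quadInc_smul (f : E n → ℝ) (y s : E n) (t : ℝ) :
    quadInc f y (t • s) = t * ⟪gradient f y, s⟫ + t ^ 2 * (1 / 2 * ⟪s, hess f y s⟫) := by
  simp only [quadInc, map_smul, real_inner_smul_left, real_inner_smul_right]
  ring

theorem quadInc_neg (f : E n → ℝ) (y s : E n) :
    quadInc f y (-s) = quadInc f y s - 2 * ⟪gradient f y, s⟫ := by
  simp only [quadInc, map_neg, inner_neg_left, inner_neg_right]
  ring

theorem quadInc_add (hf : ContDiff ℝ 2 f) (y s d : E n) :
    quadInc f y (s + d) = quadInc f y s + ⟪gradient f y + hess f y s, d⟫ +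
      1 / 2 * ⟪d, hess f y d⟫ := by
  have h1 : ⟪d, hess f y s⟫ = ⟪hess f y s, d⟫ := real_inner_comm _ _
  have h2 : ⟪s, hess f y d⟫ = ⟪hess f y s, d⟫ := (inner_hess_comm hf y s d).symm
  simp only [quadInc, map_add, inner_add_left, inner_add_right, h1, h2]
  ring

/-- The two sides differ by `-t * (1 - t) * ⟪gradient f y, s⟫`. The model therefore predicts
decrease along the whole segment, which keeps the segment in `Lp`. -/
theorem quadInc_smul_le {y s : E n} (hs : ⟪gradient f y, s⟫ ≤ 0) {t : ℝ}
    (ht : t ∈ Icc (0 : ℝ) 1) : quadInc f y (t • s) ≤ t ^ 2 * quadInc f y s := by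
  rw [quadInc_smul, quadInc]
  nlinarith [mul_nonneg ht.1 (sub_nonneg.2 ht.2), mul_nonneg (mul_nonneg ht.1 (sub_nonneg.2 ht.2))
    (neg_nonneg.2 hs)]

variable {x₀ : E n} {Lp : Set (E n)} {L₁ L₂ M₁ M₂ : ℝ}

/-- A descent direction whose model error is dominated by the model reduction leads to a trial
point at which the actual reduction is at least the model reduction minus the error. -/
theorem StandingAssumptions.reduction_ge (h : StandingAssumptions f x₀ Lp L₁ L₂ M₁ M₂)
    {x s : E n} (hx : x ∈ levelSet f x₀) (hs : ⟪gradient f x, s⟫ ≤ 0) {e : ℝ}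
    (herr : ∀ t ∈ Icc (0 : ℝ) 1, x + t • s ∈ Lp →
      f (x + t • s) - f x - quadInc f x (t • s) ≤ t ^ 2 * e)
    (he : quadInc f x s + e ≤ 0) : x + s ∈ Lp ∧ -quadInc f x s - e ≤ f x - f (x + s) := by
  have hm : x + s ∈ Lp := by
    refine h.segment_subset hx fun t ht hmem => ?_
    have h1 := herr t ht hmem
    have h2 := quadInc_smul_le hs ht
    nlinarith [sq_nonneg t]
  refine ⟨hm, ?_⟩
  have := herr 1 (by simp) (by simpa using hm)
  simp only [one_smul, one_pow, one_mul] at this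
  linarith

theorem StandingAssumptions.error_le_two (h : StandingAssumptions f x₀ Lp L₁ L₂ M₁ M₂)
    {x s : E n} (hx : x ∈ Lp) : ∀ t ∈ Icc (0 : ℝ) 1, x + t • s ∈ Lp →
      f (x + t • s) - f x - quadInc f x (t • s) ≤ t ^ 2 * (L₂ / 6 * ‖s‖ ^ 3) := by
  intro t ht hm
  have h1 := (abs_le.1 (h.taylor_two hx hm)).2
  rw [norm_smul, Real.norm_of_nonneg ht.1] at h1
  have h2 : t ^ 3 ≤ t ^ 2 := pow_le_pow_of_le_one ht.1 ht.2 (by norm_num)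
  have h3 : 0 ≤ L₂ / 6 * ‖s‖ ^ 3 := by have := h.L₂_pos; positivity
  nlinarith

/-- The first-order Taylor remainder and the quadratic term of the model contribute `L₁ / 2` each.
This error matches a radius proportional to `‖g‖`, for which the predicted reduction is of order
`‖g‖ ^ 2`. -/
theorem StandingAssumptions.error_le_one (h : StandingAssumptions f x₀ Lp L₁ L₂ M₁ M₂)
    {x s : E n} (hx : x ∈ Lp) : ∀ t ∈ Icc (0 : ℝ) 1, x + t • s ∈ Lp →
      f (x + t • s) - f x - quadInc f x (t • s) ≤ t ^ 2 * (L₁ * ‖s‖ ^ 2) := by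
  intro t ht hm
  have h1 := (abs_le.1 (h.taylor_one hx hm)).2
  have h2 := (abs_le.1 (h.inner_hess_le hx (t • s))).1
  rw [norm_smul, Real.norm_of_nonneg ht.1] at h1 h2
  rw [quadInc]
  nlinarith

end Models

/-! ### Trust-region steps: acceptance and reduction. -/

section TrustRegion

variable {n : ℕ} {f : E n → ℝ} {δ : ℝ} {y s : E n}

theorem IsTRStep.inner_nonpos (h : IsTRStep f δ y s) : ⟪gradient f y, s⟫ ≤ 0 := by
  have := h.2 (-s) (by simpa using h.1)
  rw [quadInc_neg] at this
  linarith

theorem IsTRStep.quadInc_nonpos (h : IsTRStep f δ y s) : quadInc f y s ≤ 0 := by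
  have := h.2 0 (by simpa using (norm_nonneg s).trans h.1)
  rwa [quadInc_zero] at this

theorem IsTRStep.quadInc_le_negCurv (h : IsTRStep f δ y s) (hf : ContDiff ℝ 2 f) :
    quadInc f y s ≤ -(1 / 2 * negCurv f y * δ ^ 2) := by
  have hδ : 0 ≤ δ := (norm_nonneg s).trans h.1
  rcases (negCurv_nonneg f y).eq_or_lt with h0 | h0
  · rw [← h0]
    simpa using h.quadInc_nonpos
  obtain ⟨v, hv, hg, hH⟩ := exists_negCurv_direction hf h0
  have h1 := h.2 (δ • v) (by rw [norm_smul, hv, Real.norm_of_nonneg hδ, mul_one])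
  rw [quadInc_smul, hH] at h1
  nlinarith [mul_nonneg hδ (neg_nonneg.2 hg)]

variable {x₀ : E n} {Lp : Set (E n)} {L₁ L₂ M₁ M₂ : ℝ}

/-- Comparison with the gradient step `-α g`, feasible by `hαδ`. By `hαL` the curvature term
consumes at most half of the first-order decrease `α ‖g‖ ^ 2`. -/
theorem IsTRStep.quadInc_le_gradient (h : IsTRStep f δ y s)
    (hSA : StandingAssumptions f x₀ Lp L₁ L₂ M₁ M₂) (hy : y ∈ Lp) {α : ℝ} (hα : 0 ≤ α)
    (hαL : α * L₁ ≤ 1) (hαδ : α * ‖gradient f y‖ ≤ δ) :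
    quadInc f y s ≤ -(α / 2 * ‖gradient f y‖ ^ 2) := by
  have h1 := h.2 ((-α) • gradient f y) (by
    rwa [norm_smul, norm_neg, Real.norm_of_nonneg hα])
  rw [quadInc_smul, real_inner_self_eq_norm_sq] at h1
  have h2 := (abs_le.1 (hSA.inner_hess_le hy (gradient f y))).2
  have h3 : α ^ 2 * (1 / 2 * ⟪gradient f y, hess f y (gradient f y)⟫) ≤
      α ^ 2 * (1 / 2 * (L₁ * ‖gradient f y‖ ^ 2)) := by gcongr
  have h4 : α * (α * L₁) * (1 / 2 * ‖gradient f y‖ ^ 2) ≤ α * 1 * (1 / 2 * ‖gradient f y‖ ^ 2) := by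
    gcongr
  nlinarith

/-- A trust-region step is accepted whenever the parameter `ν` is large enough. -/
theorem StandingAssumptions.trStep_accepted (h : StandingAssumptions f x₀ Lp L₁ L₂ M₁ M₂)
    (hy : y ∈ levelSet f x₀) {η ν : ℝ} (hη₀ : 0 < η) (hη : η < 1)
    (hν : (2 * L₁ + L₂) / (1 - η) ≤ ν) (hs : IsTRStep f (trHRadius f ν y) y s) :
    η * -quadInc f y s ≤ f y - f (y + s) := by
  have hL₁ := h.L₁_pos
  have hL₂ := h.L₂_pos
  have h1η : 0 < 1 - η := by linarith
  have hyL := h.subset hy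
  rw [div_le_iff₀ h1η] at hν
  have hνL : 2 * L₁ + L₂ ≤ ν := by
    have : 0 < ν := by
      by_contra hc
      nlinarith
    nlinarith
  have hν0 : 0 < ν := by linarith
  have hq := hs.quadInc_nonpos
  -- It suffices that the model error is at most the fraction `1 - η` of the predicted reduction.
  -- With the gradient radius the error is of order `‖g‖ ^ 2 / ν ^ 2` against `‖g‖ ^ 2 / ν`. With
  -- the curvature radius it is of order `negCurv ^ 3 / ν ^ 3` against `negCurv ^ 3 / ν ^ 2`.
  have key : ∀ e : ℝ, (∀ t ∈ Icc (0 : ℝ) 1, y + t • s ∈ Lp →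
      f (y + t • s) - f y - quadInc f y (t • s) ≤ t ^ 2 * e) →
      e ≤ (1 - η) * -quadInc f y s → η * -quadInc f y s ≤ f y - f (y + s) := by
    intro e he1 he2
    have := (h.reduction_ge hy hs.inner_nonpos he1 (by nlinarith)).2
    linarith
  unfold trHRadius at hs
  split_ifs at hs with hc
  · refine key _ (h.error_le_one hyL) ?_
    have h1 := hs.quadInc_le_gradient h hyL (α := 1 / ν) (by positivity)
      (by rw [one_div_mul_eq_div, div_le_one hν0]; linarith) le_rfl
    have h2 : ‖s‖ ^ 2 ≤ (1 / ν * ‖gradient f y‖) ^ 2 := by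
      gcongr
      exact hs.1
    calc L₁ * ‖s‖ ^ 2 ≤ L₁ * (1 / ν * ‖gradient f y‖) ^ 2 := by gcongr
      _ = L₁ / ν * (1 / ν * ‖gradient f y‖ ^ 2) := by ring
      _ ≤ (1 - η) / 2 * (1 / ν * ‖gradient f y‖ ^ 2) := by
        gcongr ?_ * _
        rw [div_le_div_iff₀ hν0 two_pos]
        linarith
      _ = (1 - η) * (1 / ν / 2 * ‖gradient f y‖ ^ 2) := by ring
      _ ≤ _ := by gcongr; linarith
  · refine key _ (h.error_le_two hyL) ?_
    have h1 := hs.quadInc_le_negCurv h.smooth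
    have hN := negCurv_nonneg f y
    have h2 : ‖s‖ ^ 3 ≤ (1 / ν * negCurv f y) ^ 3 := by
      gcongr
      exact hs.1
    calc L₂ / 6 * ‖s‖ ^ 3 ≤ L₂ / 6 * (1 / ν * negCurv f y) ^ 3 := by gcongr
      _ = L₂ / 6 / ν * (negCurv f y * (1 / ν * negCurv f y) ^ 2) := by ring
      _ ≤ (1 - η) / 2 * (negCurv f y * (1 / ν * negCurv f y) ^ 2) := by
        gcongr ?_ * _
        rw [div_le_iff₀ hν0]
        linarith
      _ = (1 - η) * (1 / 2 * negCurv f y * (1 / ν * negCurv f y) ^ 2) := by ring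
      _ ≤ _ := by gcongr; linarith

/-- The model reduction of a trust-region step bounds both optimality measures. -/
theorem StandingAssumptions.trStep_reduction (h : StandingAssumptions f x₀ Lp L₁ L₂ M₁ M₂)
    (hy : y ∈ levelSet f x₀) {ν νb : ℝ} (hν : 0 < ν) (hνb : ν ≤ νb)
    (hs : IsTRStep f (trHRadius f ν y) y s) :
    ‖gradient f y‖ ^ 2 ≤ (2 * (L₁ + νb) + 2 * νb ^ 2) * -quadInc f y s ∧
    negCurv f y ^ 3 ≤ (2 * (L₁ + νb) + 2 * νb ^ 2) * -quadInc f y s := by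
  have hL₁ := h.L₁_pos
  have hyL := h.subset hy
  have hνb0 : 0 < νb := by linarith
  have hq := hs.quadInc_nonpos
  have hN := negCurv_nonneg f y
  -- The rule for the radius selects the larger of `‖g‖ ^ 2` and `negCurv ^ 3`, so bounding the
  -- selected one bounds both.
  suffices hmax : ∃ M, ‖gradient f y‖ ^ 2 ≤ M ∧ negCurv f y ^ 3 ≤ M ∧
      M ≤ (2 * (L₁ + νb) + 2 * νb ^ 2) * -quadInc f y s by
    obtain ⟨M, h1, h2, h3⟩ := hmax
    exact ⟨h1.trans h3, h2.trans h3⟩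
  unfold trHRadius at hs
  split_ifs at hs with hc
  · refine ⟨_, le_rfl, hc, ?_⟩
    -- This `α` is below both `1 / L₁` and `1 / ν`, so the gradient step is short enough and
    -- feasible.
    have h1 := hs.quadInc_le_gradient h hyL (α := 1 / (L₁ + νb)) (by positivity)
      (by rw [one_div_mul_eq_div, div_le_one (by positivity)]; linarith) (by
        gcongr
        linarith)
    calc ‖gradient f y‖ ^ 2 = 2 * (L₁ + νb) * (1 / (L₁ + νb) / 2 * ‖gradient f y‖ ^ 2) := by
          field_simp
      _ ≤ 2 * (L₁ + νb) * -quadInc f y s := by gcongr; linarith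
      _ ≤ _ := by
        gcongr
        · linarith
        · nlinarith
  · push Not at hc
    refine ⟨_, hc.le, le_rfl, ?_⟩
    have h1 := hs.quadInc_le_negCurv h.smooth
    calc negCurv f y ^ 3 = 2 * ν ^ 2 * (1 / 2 * negCurv f y * (1 / ν * negCurv f y) ^ 2) := by
          field_simp
      _ ≤ 2 * ν ^ 2 * -quadInc f y s := by gcongr; linarith
      _ ≤ _ := by
        gcongr
        · linarith
        · nlinarith

end TrustRegion

/-! ### Cubically regularized steps: optimality conditions and reduction. -/

section Cubic

variable {n : ℕ} {f : E n → ℝ} {ν : ℝ} {y s : E n}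

theorem IsCubicStep.inner_nonpos (h : IsCubicStep f ν y s) : ⟪gradient f y, s⟫ ≤ 0 := by
  have := h (-s)
  rw [cubicInc, cubicInc, quadInc_neg, norm_neg] at this
  linarith

/-- Stationarity at `t = 1` of the model along the ray `t ↦ t • s`. -/
theorem IsCubicStep.inner_hess_eq (h : IsCubicStep f ν y s) :
    ⟪gradient f y, s⟫ + ⟪s, hess f y s⟫ + ν * ‖s‖ ^ 3 = 0 := by
  have hd : HasDerivAt (fun t : ℝ => t * ⟪gradient f y, s⟫ +
      t ^ 2 * (1 / 2 * ⟪s, hess f y s⟫) + t ^ 3 * (ν / 3 * ‖s‖ ^ 3))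
      (⟪gradient f y, s⟫ + ⟪s, hess f y s⟫ + ν * ‖s‖ ^ 3) 1 := by
    have := (((hasDerivAt_id' (1 : ℝ)).mul_const ⟪gradient f y, s⟫).fun_add
      ((hasDerivAt_pow 2 (1 : ℝ)).mul_const (1 / 2 * ⟪s, hess f y s⟫))).fun_add
      ((hasDerivAt_pow 3 (1 : ℝ)).mul_const (ν / 3 * ‖s‖ ^ 3))
    refine this.congr_deriv ?_
    norm_num
    ring
  refine IsLocalMin.hasDerivAt_eq_zero ?_ hd
  filter_upwards [lt_mem_nhds (zero_lt_one (α := ℝ))] with t ht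
  have := h (t • s)
  rw [cubicInc, cubicInc, quadInc_smul, quadInc, norm_smul, Real.norm_of_nonneg ht.le] at this
  linarith

theorem IsCubicStep.cubicInc_eq (h : IsCubicStep f ν y s) :
    cubicInc f ν y s = 1 / 2 * ⟪gradient f y, s⟫ - ν / 6 * ‖s‖ ^ 3 := by
  have := h.inner_hess_eq
  rw [cubicInc, quadInc]
  linarith

theorem IsCubicStep.cubicInc_le_norm (h : IsCubicStep f ν y s) :
    cubicInc f ν y s ≤ -(ν / 6 * ‖s‖ ^ 3) := by
  have := h.cubicInc_eq
  have := h.inner_nonpos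
  linarith

theorem nonneg_of_forall_add_mul_nonneg {a b : ℝ} (h : ∀ t ∈ Ioc (0 : ℝ) 1, 0 ≤ a + t * b) :
    0 ≤ a := by
  by_contra! ha
  have h1 := h (min 1 (-a / (2 * (|b| + 1)))) ⟨lt_min one_pos (by
    have := neg_pos.2 ha
    positivity), min_le_left _ _⟩
  set t := min 1 (-a / (2 * (|b| + 1)))
  have h2 : t * (2 * (|b| + 1)) ≤ -a := by
    rw [← le_div_iff₀ (by positivity)]
    exact min_le_right _ _
  have h3 : 0 ≤ t := le_min zero_le_one (by
    have := neg_pos.2 ha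
    positivity)
  nlinarith [le_abs_self b, mul_nonneg h3 (sub_nonneg.2 (le_abs_self b)), abs_nonneg b]

/-- First-order optimality in norm form: moving from `s` to `s - t w`, with `w` the residual,
changes the model by at most `t * (-‖w‖ ^ 2 + ν * ‖s‖ ^ 2 * ‖w‖) + O(t ^ 2)`. The coefficient of `t`
must be nonnegative. The triangle inequality for `‖s - t w‖` replaces differentiation of the cubed
norm. -/
theorem IsCubicStep.norm_gradient_add_hess_le (h : IsCubicStep f ν y s) (hf : ContDiff ℝ 2 f)
    (hν : 0 ≤ ν) : ‖gradient f y + hess f y s‖ ≤ ν * ‖s‖ ^ 2 := by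
  set w := gradient f y + hess f y s with hw
  have h1 : 0 ≤ -‖w‖ ^ 2 + ν * ‖s‖ ^ 2 * ‖w‖ := by
    refine nonneg_of_forall_add_mul_nonneg
      (b := 1 / 2 * ⟪w, hess f y w⟫ + ν * ‖s‖ * ‖w‖ ^ 2 + ν / 3 * ‖w‖ ^ 3) fun t ht => ?_
    have h2 := h (s + (-t) • w)
    rw [cubicInc, cubicInc, quadInc_add hf, ← hw, real_inner_smul_right,
      real_inner_self_eq_norm_sq, map_smul, real_inner_smul_left, real_inner_smul_right] at h2
    have h3 : ‖s + (-t) • w‖ ≤ ‖s‖ + t * ‖w‖ := by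
      refine (norm_add_le _ _).trans ?_
      rw [norm_smul, norm_neg, Real.norm_of_nonneg ht.1.le]
    have h4 : ν / 3 * ‖s + (-t) • w‖ ^ 3 ≤ ν / 3 * (‖s‖ + t * ‖w‖) ^ 3 := by gcongr
    have h5 : 0 ≤ t * (-‖w‖ ^ 2 + ν * ‖s‖ ^ 2 * ‖w‖ +
        t * (1 / 2 * ⟪w, hess f y w⟫ + ν * ‖s‖ * ‖w‖ ^ 2 + ν / 3 * ‖w‖ ^ 3)) := by
      have h6 : t ^ 3 * (ν / 3 * ‖w‖ ^ 3) ≤ t ^ 2 * (ν / 3 * ‖w‖ ^ 3) := by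
        have := pow_le_pow_of_le_one ht.1.le ht.2 (show 2 ≤ 3 by norm_num)
        gcongr ?_ * _
      nlinarith
    exact nonneg_of_mul_nonneg_right h5 ht.1
  rcases (norm_nonneg w).eq_or_lt with h0 | h0
  · rw [← h0]
    positivity
  · nlinarith

/-- Comparison with the step of length `N / ν`, `N = negCurv f y`, along a direction of most
negative curvature. This length minimizes `-N t ^ 2 / 2 + ν t ^ 3 / 3`, with value `-N ^ 3 / (6 ν ^
2)`. -/
theorem IsCubicStep.cubicInc_le_negCurv (h : IsCubicStep f ν y s) (hf : ContDiff ℝ 2 f)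
    (hν : 0 < ν) : cubicInc f ν y s ≤ -(negCurv f y ^ 3 / (6 * ν ^ 2)) := by
  rcases (negCurv_nonneg f y).eq_or_lt with h0 | h0
  · rw [← h0]
    simpa [cubicInc, quadInc_zero] using h 0
  obtain ⟨v, hv, hg, hH⟩ := exists_negCurv_direction hf h0
  set N := negCurv f y
  have h1 := h ((N / ν) • v)
  have h2 : 0 < N / ν := by positivity
  rw [cubicInc.eq_1 f ν y ((N / ν) • v), quadInc_smul, hH, norm_smul, hv, Real.norm_of_nonneg h2.le,
    mul_one] at h1
  have h3 : (N / ν) ^ 2 * (1 / 2 * -N) + ν / 3 * (N / ν) ^ 3 = -(N ^ 3 / (6 * ν ^ 2)) := by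
    field_simp
    ring
  nlinarith [mul_nonneg h2.le (neg_nonneg.2 hg)]

variable {x₀ : E n} {Lp : Set (E n)} {L₁ L₂ M₁ M₂ : ℝ}

/-- A step of the cubically regularized model achieves the full model reduction whenever the
regularization parameter is large enough. -/
theorem StandingAssumptions.cubicStep_accepted (h : StandingAssumptions f x₀ Lp L₁ L₂ M₁ M₂)
    (hy : y ∈ levelSet f x₀) (hν : L₂ / 2 ≤ ν) (hs : IsCubicStep f ν y s) :
    -cubicInc f ν y s ≤ f y - f (y + s) := by
  have hL₂ := h.L₂_pos
  -- For `ν ≥ L₂ / 2` the regularization term `ν / 3` dominates the Taylor error `L₂ / 6`, so the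
  -- cubic model overestimates `f`.
  have h1 : quadInc f y s + L₂ / 6 * ‖s‖ ^ 3 ≤ cubicInc f ν y s := by
    rw [cubicInc]
    gcongr _ + ?_ * _
    linarith
  have h2 := hs.cubicInc_le_norm
  have h3 : 0 ≤ ν / 6 * ‖s‖ ^ 3 := by
    have : 0 ≤ ν := by linarith
    positivity
  have := (h.reduction_ge hy hs.inner_nonpos (h.error_le_two (h.subset hy)) (by linarith)).2
  linarith

/-- The reduction achieved by an accepted step of the cubically regularized model bounds both
optimality measures at the new point. -/
theorem StandingAssumptions.cubicStep_reduction (h : StandingAssumptions f x₀ Lp L₁ L₂ M₁ M₂)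
    (hy : y ∈ levelSet f x₀) {η νa νb : ℝ} (hη : 0 < η) (hνa : 0 < νa) (ha : νa ≤ ν) (hb : ν ≤ νb)
    (hs : IsCubicStep f ν y s) (hacc : η * -cubicInc f ν y s ≤ f y - f (y + s)) :
    let Z := (L₂ / 2 + νb) ^ (3 / 2 : ℝ) * (6 / (η * νa)) + 4 * (6 * νb ^ 2 / η) +
      4 * L₂ ^ 3 * (6 / (η * νa))
    ‖gradient f (y + s)‖ ^ (3 / 2 : ℝ) ≤ Z * (f y - f (y + s)) ∧
    negCurv f (y + s) ^ 3 ≤ Z * (f y - f (y + s)) := by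
  intro Z
  have hL₂ := h.L₂_pos
  have hν : 0 < ν := by linarith
  have hνb : 0 < νb := by linarith
  set d := f y - f (y + s) with hd
  have hsr : ‖s‖ ^ 3 ≤ 6 / (η * νa) * d := by
    have h1 := hs.cubicInc_le_norm
    rw [div_mul_eq_mul_div, le_div_iff₀ (by positivity)]
    have h2 : νa * ‖s‖ ^ 3 ≤ ν * ‖s‖ ^ 3 := by gcongr
    nlinarith
  have hd0 : 0 ≤ d := by
    by_contra hc
    have : 6 / (η * νa) * d < 0 := mul_neg_of_pos_of_neg (by positivity) (by linarith)
    have : 0 ≤ ‖s‖ ^ 3 := by positivity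
    linarith
  have hN := negCurv_nonneg f y
  have hNr : negCurv f y ^ 3 ≤ 6 * νb ^ 2 / η * d := by
    have h1 := hs.cubicInc_le_negCurv h.smooth hν
    have h2 : η * (negCurv f y ^ 3 / (6 * ν ^ 2)) ≤ d :=
      le_trans (by gcongr; linarith) hacc
    rw [div_mul_eq_mul_div, le_div_iff₀ hη]
    rw [← mul_div_assoc, div_le_iff₀ (by positivity)] at h2
    have h3 : d * (6 * ν ^ 2) ≤ d * (6 * νb ^ 2) := by gcongr
    linarith
  have hyL := h.subset hy
  have hsL : y + s ∈ Lp := h.subset (show f (y + s) ≤ f x₀ by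
    have : f y ≤ f x₀ := hy
    linarith)
  have hp : (0 : ℝ) ≤ (L₂ / 2 + νb) ^ (3 / 2 : ℝ) := by positivity
  constructor
  -- The new gradient is a Taylor remainder plus the model residual, both of order `‖s‖ ^ 2`, while
  -- the reduction controls `‖s‖ ^ 3`. This is the origin of the exponent `3 / 2`.
  · have h1 := h.gradient_taylor hyL hsL
    have h2 := hs.norm_gradient_add_hess_le h.smooth hν.le
    have h3 : ‖gradient f (y + s)‖ ≤ (L₂ / 2 + νb) * ‖s‖ ^ 2 := by
      calc _ = ‖(gradient f (y + s) - gradient f y - hess f y s) +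
            (gradient f y + hess f y s)‖ := by congr 1; abel
        _ ≤ L₂ / 2 * ‖s‖ ^ 2 + ν * ‖s‖ ^ 2 := (norm_add_le _ _).trans (add_le_add h1 h2)
        _ ≤ L₂ / 2 * ‖s‖ ^ 2 + νb * ‖s‖ ^ 2 := by gcongr
        _ = _ := by ring
    calc ‖gradient f (y + s)‖ ^ (3 / 2 : ℝ) ≤ ((L₂ / 2 + νb) * ‖s‖ ^ 2) ^ (3 / 2 : ℝ) := by gcongr
      _ = (L₂ / 2 + νb) ^ (3 / 2 : ℝ) * ‖s‖ ^ 3 := by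
        rw [Real.mul_rpow (by positivity) (by positivity), ← Real.rpow_natCast_mul (norm_nonneg s)]
        norm_num
      _ ≤ (L₂ / 2 + νb) ^ (3 / 2 : ℝ) * (6 / (η * νa) * d) := by gcongr
      _ ≤ Z * d := by
        rw [← mul_assoc]
        gcongr
        simp only [Z, add_assoc]
        have : 0 ≤ 4 * (6 * νb ^ 2 / η) + 4 * L₂ ^ 3 * (6 / (η * νa)) := by positivity
        linarith
  · have h1 := h.negCurv_le_add hyL hsL
    rw [add_sub_cancel_left] at h1
    calc negCurv f (y + s) ^ 3 ≤ (negCurv f y + L₂ * ‖s‖) ^ 3 := by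
          gcongr
          exact negCurv_nonneg _ _
      _ ≤ 4 * (negCurv f y ^ 3 + (L₂ * ‖s‖) ^ 3) := by
        have := add_pow_le hN (show 0 ≤ L₂ * ‖s‖ by positivity) 3
        norm_num at this
        exact this
      _ = 4 * negCurv f y ^ 3 + 4 * L₂ ^ 3 * ‖s‖ ^ 3 := by ring
      _ ≤ 4 * (6 * νb ^ 2 / η * d) + 4 * L₂ ^ 3 * (6 / (η * νa) * d) := by gcongr
      _ = (4 * (6 * νb ^ 2 / η) + 4 * L₂ ^ 3 * (6 / (η * νa))) * d := by ring
      _ ≤ Z * d := by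
        gcongr
        simp only [Z, add_assoc]
        have : 0 ≤ (L₂ / 2 + νb) ^ (3 / 2 : ℝ) * (6 / (η * νa)) := by positivity
        linarith

end Cubic

/-- The power of the gradient norm that the reductions achieved by the method dominate. -/
noncomputable def Method.gradExponent : Method → ℝ
  | .trH _ _ _ _ => 2
  | .rn _ => 3 / 2
  | .rnA _ _ _ _ => 3 / 2

/-! ### Adaptive parameter updates and progress over `m` iterations. -/

section Adaptive

variable {n : ℕ} {f : E n → ℝ} {x₀ : E n} {η ψ νmin νmax θ : ℝ} {pred : ℕ → ℝ}
  {x s : ℕ → E n} {ν : ℕ → ℝ}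

theorem AdaptiveUpdate.succ_le (h : AdaptiveUpdate f η ψ νmin νmax pred x s ν) (hη : 0 < η)
    (hpred : ∀ k, 0 ≤ pred k) (k : ℕ) : f (x (k + 1)) ≤ f (x k) := by
  by_cases hk : η * pred k ≤ f (x k) - f (x k + s k)
  · rw [((h.2 k).1 hk).1]
    have := mul_nonneg hη.le (hpred k)
    linarith
  · rw [((h.2 k).2 hk).1]

theorem AdaptiveUpdate.antitone (h : AdaptiveUpdate f η ψ νmin νmax pred x s ν) (hη : 0 < η)
    (hpred : ∀ k, 0 ≤ pred k) : Antitone fun k => f (x k) :=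
  antitone_nat_of_succ_le (h.succ_le hη hpred)

theorem AdaptiveUpdate.mem_levelSet (h : AdaptiveUpdate f η ψ νmin νmax pred x s ν) (hη : 0 < η)
    (hpred : ∀ k, 0 ≤ pred k) (hx : x 0 = x₀) (k : ℕ) : x k ∈ levelSet f x₀ := by
  have := h.antitone hη hpred (Nat.zero_le k)
  simp only [hx] at this
  exact this

theorem AdaptiveUpdate.le_nu (h : AdaptiveUpdate f η ψ νmin νmax pred x s ν) (hψ : 1 < ψ)
    (hνmin : 0 < νmin) (k : ℕ) : νmin ≤ ν k := by
  induction k with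
  | zero => exact h.1.1
  | succ k ih =>
    by_cases hk : η * pred k ≤ f (x k) - f (x k + s k)
    · exact ((h.2 k).1 hk).2.1
    · rw [((h.2 k).2 hk).2]
      nlinarith

/-- A rejection happens only below the threshold `θ`, so a rejected step leaves the parameter below
`ψ * θ`. -/
theorem AdaptiveUpdate.nu_le (h : AdaptiveUpdate f η ψ νmin νmax pred x s ν) (hψ : 1 < ψ)
    (hacc : ∀ k, θ ≤ ν k → η * pred k ≤ f (x k) - f (x k + s k)) (k : ℕ) :
    ν k ≤ max νmax (ψ * θ) := by
  rcases k with _ | k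
  · exact h.1.2.trans (le_max_left _ _)
  · by_cases hk : η * pred k ≤ f (x k) - f (x k + s k)
    · exact ((h.2 k).1 hk).2.2.trans (le_max_left _ _)
    · rw [((h.2 k).2 hk).2]
      have : ν k < θ := lt_of_not_ge fun hc => hk (hacc k hc)
      exact le_trans (by gcongr) (le_max_right _ _)

/-- From any iteration on, an accepted step occurs before the parameter has been increased to the
acceptance threshold. -/
theorem AdaptiveUpdate.exists_accepted (h : AdaptiveUpdate f η ψ νmin νmax pred x s ν)
    (hacc : ∀ k, θ ≤ ν k → η * pred k ≤ f (x k) - f (x k + s k)) (r : ℕ) :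
    ∀ k, θ ≤ ψ ^ r * ν k → ∃ i, k ≤ i ∧ i ≤ k + r ∧ x i = x k ∧
      η * pred i ≤ f (x i) - f (x i + s i) := by
  induction r with
  | zero => exact fun k hk => ⟨k, le_rfl, le_rfl, rfl, hacc k (by simpa using hk)⟩
  | succ r ih =>
    intro k hk
    by_cases hk' : η * pred k ≤ f (x k) - f (x k + s k)
    · exact ⟨k, le_rfl, by omega, rfl, hk'⟩
    · obtain ⟨hx, hν⟩ := (h.2 k).2 hk'
      obtain ⟨i, h1, h2, h3, h4⟩ := ih (k + 1) (by
        rw [hν]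
        calc θ ≤ _ := hk
          _ = _ := by ring)
      exact ⟨i, by omega, by omega, h3.trans hx, h4⟩

end Adaptive

/-- The progress that the iterates of a run make: they stay in the sublevel set, the objective
values are nonincreasing, the parameters `ν k` stay in `[νa, νb]`, and within any `m` iterations
the reduction dominates the powers of the optimality measures at one of the iterates. -/
structure Progress {n : ℕ} (f : E n → ℝ) (x₀ : E n) (x : ℕ → E n) (ν : ℕ → ℝ)
    (θ Z νa νb : ℝ) (m : ℕ) : Prop where
  mem : ∀ k, x k ∈ levelSet f x₀
  anti : Antitone fun k => f (x k)
  le_nu : ∀ k, νa ≤ ν k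
  nu_le : ∀ k, ν k ≤ νb
  reduction : ∀ k, ∃ p, k ≤ p ∧ p ≤ k + m ∧
    ‖gradient f (x p)‖ ^ θ ≤ Z * (f (x k) - f (x (k + m))) ∧
    negCurv f (x p) ^ 3 ≤ Z * (f (x k) - f (x (k + m)))

/-- One `r` serves all starting parameters `ν ≥ νmin`: after `r` consecutive rejections the
threshold is reached. The adaptive methods take `m = r + 1`. -/
theorem exists_pow_mul_ge {ψ νmin : ℝ} (hψ : 1 < ψ) (hνmin : 0 < νmin) (θ : ℝ) :
    ∃ r : ℕ, ∀ ν, νmin ≤ ν → θ ≤ ψ ^ r * ν := by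
  obtain ⟨r, hr⟩ := pow_unbounded_of_one_lt (θ / νmin) hψ
  refine ⟨r, fun ν hν => ?_⟩
  rw [div_lt_iff₀ hνmin] at hr
  have : ψ ^ r * νmin ≤ ψ ^ r * ν := by gcongr
  linarith

/-- Every run of an admissible method makes progress, with constants that depend only on the
Lipschitz constants and the method. -/
theorem Method.exists_progress (alg : Method) {L₁ L₂ : ℝ} (hL₁ : 0 < L₁) (hL₂ : 0 < L₂)
    (halg : alg.Admissible L₂) :
    ∃ Z νa νb : ℝ, ∃ m : ℕ, 0 < Z ∧ 0 < νa ∧ 0 < m ∧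
    ∀ (n : ℕ) (f : E n → ℝ) (x₀ : E n) (Lp : Set (E n)) (M₁ M₂ : ℝ),
      StandingAssumptions f x₀ Lp L₁ L₂ M₁ M₂ →
      ∀ (x s : ℕ → E n) (ν : ℕ → ℝ), x 0 = x₀ → alg.IsRun f x s ν →
      Progress f x₀ x ν alg.gradExponent Z νa νb m := by
  rcases alg with ⟨η, ψ, νmin, νmax⟩ | ⟨l₂⟩ | ⟨η, ψ, νmin, νmax⟩
  · obtain ⟨hη₀, hη₁, hψ, hνmin, hνle⟩ := halg
    set θ := (2 * L₁ + L₂) / (1 - η) with hθ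
    set νb := max νmax (ψ * θ) with hνb
    obtain ⟨r, hr⟩ := exists_pow_mul_ge hψ hνmin θ
    have hνb0 : 0 < νb := (hνmin.trans_le hνle).trans_le (le_max_left _ _)
    refine ⟨(2 * (L₁ + νb) + 2 * νb ^ 2) / η, νmin, νb, r + 1, by positivity, hνmin, by omega, ?_⟩
    intro n f x₀ Lp M₁ M₂ h x s ν hx hrun
    obtain ⟨hstep, hup⟩ := hrun
    have hpred : ∀ k, 0 ≤ -quadInc f (x k) (s k) := fun k => neg_nonneg.2 (hstep k).quadInc_nonpos
    have hmem := hup.mem_levelSet hη₀ hpred hx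
    have hacc : ∀ k, θ ≤ ν k → η * -quadInc f (x k) (s k) ≤ f (x k) - f (x k + s k) :=
      fun k hk => h.trStep_accepted (hmem k) hη₀ hη₁ hk (hstep k)
    have hle := hup.le_nu hψ hνmin
    have hnu := hup.nu_le hψ hacc
    have hanti := hup.antitone hη₀ hpred
    refine ⟨hmem, hanti, hle, hnu, fun k => ?_⟩
    obtain ⟨i, h1, h2, h3, h4⟩ := hup.exists_accepted hacc r k (hr _ (hle k))
    have hred := h.trStep_reduction (hmem i) (hνmin.trans_le (hle i)) (hnu i) (hstep i)
    have h5 : f (x (k + (r + 1))) ≤ f (x i + s i) := by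
      rw [← ((hup.2 i).1 h4).1]
      exact hanti (by omega)
    have h6 : (2 * (L₁ + νb) + 2 * νb ^ 2) * -quadInc f (x i) (s i) ≤
        (2 * (L₁ + νb) + 2 * νb ^ 2) / η * (f (x k) - f (x (k + (r + 1)))) := by
      rw [div_mul_eq_mul_div, le_div_iff₀ hη₀, mul_assoc]
      gcongr
      rw [← h3]
      linarith
    -- For TR-H the measures are bounded at the point that the accepted step leaves.
    refine ⟨i, h1, by omega, ?_, hred.2.trans h6⟩
    simp only [Method.gradExponent]
    rw [Real.rpow_two]
    exact hred.1.trans h6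
  · have hl : L₂ / 2 < l₂ := halg
    have hl0 : 0 < l₂ := by linarith
    refine ⟨(L₂ / 2 + l₂) ^ (3 / 2 : ℝ) * (6 / (1 * l₂)) + 4 * (6 * l₂ ^ 2 / 1) +
      4 * L₂ ^ 3 * (6 / (1 * l₂)), l₂, l₂, 1, by positivity, hl0, one_pos, ?_⟩
    intro n f x₀ Lp M₁ M₂ h x s ν hx hrun
    have hrun' : ∀ k, ν k = l₂ ∧ IsCubicStep f l₂ (x k) (s k) ∧ x (k + 1) = x k + s k := hrun
    have hacc : ∀ k, x k ∈ levelSet f x₀ → 1 * -cubicInc f l₂ (x k) (s k) ≤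
        f (x k) - f (x k + s k) := fun k hk => by
      rw [one_mul]
      exact h.cubicStep_accepted hk hl.le (hrun' k).2.1
    have hdec : ∀ k, x k ∈ levelSet f x₀ → f (x (k + 1)) ≤ f (x k) := fun k hk => by
      have h1 := hacc k hk
      have h2 := (hrun' k).2.1.cubicInc_le_norm
      have h3 : 0 ≤ l₂ / 6 * ‖s k‖ ^ 3 := by positivity
      rw [(hrun' k).2.2]
      linarith
    have hmem : ∀ k, x k ∈ levelSet f x₀ := by
      intro k
      induction k with
      | zero => rw [hx]; exact le_refl (f x₀)
      | succ k ih => exact (hdec k ih).trans ih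
    refine ⟨hmem, antitone_nat_of_succ_le fun k => hdec k (hmem k), fun k => (hrun' k).1.ge,
      fun k => (hrun' k).1.le, fun k => ⟨k + 1, by omega, le_rfl, ?_⟩⟩
    rw [(hrun' k).2.2]
    exact h.cubicStep_reduction (hmem k) one_pos hl0 le_rfl le_rfl (hrun' k).2.1 (hacc k (hmem k))
  · obtain ⟨hη₀, hη₁, hψ, hνmin, hνle⟩ := halg
    set νb := max νmax (ψ * (L₂ / 2)) with hνb
    obtain ⟨r, hr⟩ := exists_pow_mul_ge hψ hνmin (L₂ / 2)
    have hνb0 : 0 < νb := (hνmin.trans_le hνle).trans_le (le_max_left _ _)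
    set Z := (L₂ / 2 + νb) ^ (3 / 2 : ℝ) * (6 / (η * νmin)) + 4 * (6 * νb ^ 2 / η) +
      4 * L₂ ^ 3 * (6 / (η * νmin))
    have hZ : 0 < Z := by positivity
    refine ⟨Z, νmin, νb, r + 1, hZ, hνmin, by omega, ?_⟩
    intro n f x₀ Lp M₁ M₂ h x s ν hx hrun
    obtain ⟨hstep, hup⟩ := hrun
    have hpred : ∀ k, 0 ≤ -cubicInc f (ν k) (x k) (s k) := fun k => by
      have := hstep k 0
      simp only [cubicInc, quadInc_zero, norm_zero] at this ⊢
      linarith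
    have hmem := hup.mem_levelSet hη₀ hpred hx
    have hacc : ∀ k, L₂ / 2 ≤ ν k →
        η * -cubicInc f (ν k) (x k) (s k) ≤ f (x k) - f (x k + s k) :=
      fun k hk => le_trans (by nlinarith [hpred k])
        (h.cubicStep_accepted (hmem k) hk (hstep k))
    have hle := hup.le_nu hψ hνmin
    have hnu := hup.nu_le hψ hacc
    have hanti := hup.antitone hη₀ hpred
    refine ⟨hmem, hanti, hle, hnu, fun k => ?_⟩
    obtain ⟨i, h1, h2, h3, h4⟩ := hup.exists_accepted hacc r k (hr _ (hle k))
    have hred := h.cubicStep_reduction (hmem i) hη₀ hνmin (hle i) (hnu i) (hstep i) h4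
    have hnext := ((hup.2 i).1 h4).1
    have h6 : Z * (f (x i) - f (x i + s i)) ≤ Z * (f (x k) - f (x (k + (r + 1)))) := by
      rw [← h3, ← hnext]
      gcongr
      exact hanti (by omega)
    rw [← hnext] at hred h6
    -- For the cubic model they are bounded at the point that the accepted step reaches, hence the
    -- index `i + 1`.
    exact ⟨i + 1, by omega, by omega, hred.1.trans h6, hred.2.trans h6⟩

/-! ### Scalar recursions for the gap. -/

section Scalar

/-- If `a ≥ 1` then already `u < 1 ≤ a`, otherwise `a ^ τ ≤ a`. For gaps below `1 / κ` any
admissible exponent can thus be replaced by `1`. -/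
theorem le_of_le_rpow_of_lt_one {a u τ : ℝ} (ha : 0 ≤ a) (hτ : 1 ≤ τ) (hu : u ≤ a ^ τ)
    (hu1 : u < 1) : u ≤ a := by
  rcases le_or_gt 1 a with h1 | h1
  · linarith
  · exact hu.trans (by simpa using Real.rpow_le_rpow_of_exponent_ge' ha h1.le zero_le_one hτ)

/-- For `a ≥ 1` the exponent can be raised to `p`; for `a < 1` it can be lowered to `1`, and then `a
≥ 1/2`. In the latter case `a ≤ 4 * a ^ 3` and `a ≤ 4 * a ^ 2`, which is where the factor `4` of the
next lemmas comes from. -/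
theorem half_le_or_le_pow {a u τ : ℝ} {p : ℕ} (ha : 0 ≤ a) (hτ : 1 ≤ τ) (hτp : τ ≤ p)
    (hu : u ≤ a ^ τ) (hu2 : 1 / 2 ≤ u) : u ≤ a ^ p ∨ (1 / 2 ≤ a ∧ u ≤ a) := by
  rcases le_or_gt 1 a with h1 | h1
  · left
    rw [← Real.rpow_natCast]
    exact hu.trans (Real.rpow_le_rpow_of_exponent_le h1 hτp)
  · right
    have : u ≤ a :=
      hu.trans (by simpa using Real.rpow_le_rpow_of_exponent_ge' ha h1.le zero_le_one hτ)
    exact ⟨hu2.trans this, this⟩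

theorem le_four_mul_sq {a u τ : ℝ} (ha : 0 ≤ a) (hτ : τ ∈ Icc (1 : ℝ) 2)
    (hu : u ≤ a ^ τ) (hu2 : 1 / 2 ≤ u) : u ≤ 4 * a ^ 2 := by
  rcases half_le_or_le_pow (p := 2) ha hτ.1 (by exact_mod_cast hτ.2) hu hu2 with h | ⟨h1, h2⟩
  · nlinarith [sq_nonneg a]
  · nlinarith

theorem le_four_mul_cube {a u τ : ℝ} (ha : 0 ≤ a) (hτ : τ ∈ Icc (1 : ℝ) 3)
    (hu : u ≤ a ^ τ) (hu2 : 1 / 2 ≤ u) : u ≤ 4 * a ^ 3 := by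
  rcases half_le_or_le_pow (p := 3) ha hτ.1 (by exact_mod_cast hτ.2) hu hu2 with h | ⟨h1, h2⟩
  · nlinarith [pow_nonneg ha 3]
  · have : 1 / 4 ≤ a ^ 2 := by nlinarith
    nlinarith

theorem rpow_three_halves {a : ℝ} (ha : 0 ≤ a) : a ^ (3 / 2 : ℝ) = √a ^ 3 := by
  rw [Real.sqrt_eq_rpow, ← Real.rpow_mul_natCast ha]
  norm_num

theorem sq_rpow_three_quarters {a : ℝ} (ha : 0 ≤ a) :
    (a ^ 2) ^ (3 / 4 : ℝ) = a ^ (3 / 2 : ℝ) := by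
  rw [← Real.rpow_natCast_mul ha]
  norm_num

/-- Linear decrease from a reduction proportional to the new gap. -/
theorem le_one_sub_mul_of_implicit {a b κ ζ Z : ℝ} (hκ : 0 < κ) (hZ : 0 < Z)
    (hζ : 4 * Z + κ ≤ ζ) (hb : 0 ≤ b) (h : κ * a ≤ 4 * Z * (b - a)) : a ≤ (1 - κ / ζ) * b := by
  have h1 : a ≤ (1 - κ / (4 * Z + κ)) * b := by
    have : 1 - κ / (4 * Z + κ) = 4 * Z / (4 * Z + κ) := by field_simp; ring
    rw [this, div_mul_eq_mul_div, le_div_iff₀ (by positivity)]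
    linarith
  refine h1.trans ?_
  gcongr

/-- Linear decrease, with a rate that depends on an upper bound `B` of the gap, from a reduction
proportional to the power `3/4` of the new gap. -/
theorem le_mul_of_implicit_three_quarters {a b B κ ζ Z : ℝ} (hκ : 0 < κ) (hZ : 0 < Z)
    (hζ : 4 * Z ≤ ζ) (ha : 0 ≤ a) (hab : a ≤ b) (haB : a ≤ B)
    (h : (κ * a) ^ (3 / 4 : ℝ) ≤ 4 * Z * (b - a)) :
    a ≤ B ^ (1 / 4 : ℝ) / (κ ^ (3 / 4 : ℝ) / ζ + B ^ (1 / 4 : ℝ)) * b := by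
  have hB : 0 ≤ B := ha.trans haB
  have hζ0 : 0 < ζ := by linarith
  have hk : 0 < κ ^ (3 / 4 : ℝ) := Real.rpow_pos_of_pos hκ _
  have hBp : 0 ≤ B ^ (1 / 4 : ℝ) := Real.rpow_nonneg hB _
  rw [Real.mul_rpow hκ.le ha] at h
  have h1 : κ ^ (3 / 4 : ℝ) / ζ * a ^ (3 / 4 : ℝ) ≤ b - a := by
    rw [div_mul_eq_mul_div, div_le_iff₀ hζ0]
    calc _ ≤ 4 * Z * (b - a) := h
      _ ≤ (b - a) * ζ := by rw [mul_comm]; gcongr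
  -- Bounding the factor `a ^ (1 / 4)` by `B ^ (1 / 4)` turns the power `3 / 4` into a linear term.
  have h2 : a = a ^ (1 / 4 : ℝ) * a ^ (3 / 4 : ℝ) := by
    rw [← Real.rpow_add_of_nonneg ha (by norm_num) (by norm_num)]
    norm_num
  have h3 : a ^ (1 / 4 : ℝ) ≤ B ^ (1 / 4 : ℝ) := by gcongr
  rw [div_mul_eq_mul_div, le_div_iff₀ (by positivity)]
  have h4 : a * (κ ^ (3 / 4 : ℝ) / ζ) ≤
      B ^ (1 / 4 : ℝ) * (κ ^ (3 / 4 : ℝ) / ζ * a ^ (3 / 4 : ℝ)) := by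
    calc a * (κ ^ (3 / 4 : ℝ) / ζ) =
          a ^ (1 / 4 : ℝ) * (κ ^ (3 / 4 : ℝ) / ζ * a ^ (3 / 4 : ℝ)) := by
          linear_combination (κ ^ (3 / 4 : ℝ) / ζ) * h2
      _ ≤ _ := by gcongr
  nlinarith

/-- Here `α` and `β` are the square roots of the new and the old gap; for positive values the
conclusion reads `1 / α ≥ 1 / β + c`. If `α ≤ β / 2` the halving suffices, as `c * β ≤ 1 / 10`.
Otherwise `β < 2 α`, so `(1 + c β) ^ 2 ≤ 1 + e α` and the hypothesis applies. The next two lemmas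
use the same dichotomy. -/
theorem sublinear_step_half {α β e c : ℝ} (hα : 0 ≤ α) (hβ : 0 ≤ β) (he : 0 ≤ e) (hc : 0 ≤ c)
    (hce : c ≤ e / 10) (heβ : e * β ≤ 1) (h : e * α ^ 3 ≤ β ^ 2 - α ^ 2) :
    α * (1 + c * β) ≤ β := by
  have hcβ : c * β ≤ e * β / 10 := by nlinarith
  have hcβ0 : 0 ≤ c * β := by positivity
  rcases le_or_gt α (β / 2) with h1 | h1
  · nlinarith
  · refine le_of_sq_le_sq ?_ hβ
    have h2 : (1 + c * β) ^ 2 ≤ 1 + e * α := by nlinarith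
    calc (α * (1 + c * β)) ^ 2 = α ^ 2 * (1 + c * β) ^ 2 := by ring
      _ ≤ α ^ 2 * (1 + e * α) := by gcongr
      _ ≤ β ^ 2 := by linarith

theorem sublinear_step_one {a b e c : ℝ} (ha : 0 ≤ a) (hb : 0 ≤ b) (he : 0 ≤ e) (hc : 0 ≤ c)
    (hce : c ≤ e / 10) (heb : e * b ≤ 1) (h : e * a ^ 2 ≤ b - a) : a * (1 + c * b) ≤ b := by
  have hcb : c * b ≤ e * b / 10 := by nlinarith
  have hcb0 : 0 ≤ c * b := by positivity
  rcases le_or_gt a (b / 2) with h1 | h1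
  · nlinarith
  · have h2 : c * b ≤ e * a := by nlinarith
    nlinarith

theorem sublinear_step_two {a b e c : ℝ} (ha : 0 ≤ a) (hb : 0 ≤ b) (he : 0 ≤ e) (hc : 0 ≤ c)
    (hce : c ≤ e / 10) (heb : e * b ^ 2 ≤ 1) (h : e * a ^ 3 ≤ b - a) :
    a ^ 2 * (1 + c * b ^ 2) ≤ b ^ 2 := by
  have hcb : c * b ^ 2 ≤ e * b ^ 2 / 10 := by nlinarith [sq_nonneg b]
  have hcb0 : 0 ≤ c * b ^ 2 := by positivity
  rcases le_or_gt a (b / 2) with h1 | h1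
  · have h2 : a ^ 2 ≤ (b / 2) ^ 2 := by gcongr
    have h3 : a ^ 2 * (1 + c * b ^ 2) ≤ (b / 2) ^ 2 * 2 := by
      gcongr
      linarith
    nlinarith [sq_nonneg b]
  · have h2 : (b / 2) ^ 2 ≤ a ^ 2 := by gcongr
    have h3 : c * b ^ 2 ≤ e * a ^ 2 := by nlinarith
    have h4 : a * (1 + c * b ^ 2) ≤ b := by nlinarith
    calc a ^ 2 * (1 + c * b ^ 2) ≤ a ^ 2 * (1 + c * b ^ 2) ^ 2 := by
          gcongr
          nlinarith
      _ = (a * (1 + c * b ^ 2)) ^ 2 := by ring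
      _ ≤ b ^ 2 := by gcongr

/-- For positive terms the reciprocals grow by at least `c` in each step, and this telescopes. The
multiplicative form also covers vanishing terms. -/
theorem sublinear_iterate {y : ℕ → ℝ} {c : ℝ} (hy : ∀ j, 0 ≤ y j)
    (h : ∀ j, y (j + 1) * (1 + c * y j) ≤ y j) (j : ℕ) : y j * (1 + j * c * y 0) ≤ y 0 := by
  induction j with
  | zero => simp
  | succ j ih =>
    rcases (hy j).eq_or_lt with h0 | h0
    · have h1 := h j
      rw [← h0] at h1
      have h2 : y (j + 1) = 0 := le_antisymm (by simpa using h1) (hy _)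
      rw [h2]
      simpa using hy 0
    · have h1 := mul_le_mul_of_nonneg_left (h j) (hy 0)
      have h2 := mul_le_mul_of_nonneg_left ih (hy (j + 1))
      refine le_of_mul_le_mul_left ?_ h0
      push_cast
      nlinarith

end Scalar

/-! ### Iteration counts from the decrease rates. -/

section Counting

variable {u : ℕ → ℝ} {m : ℕ}

/-- If `j > q` contractions left the value at `t` or above, then `(1 / ρ) ^ j ≤ u K / t`, that is,
`j ≤ q`. The positive logarithm covers `u K < t`. -/
theorem linear_count (hu : Antitone u) {ρ t : ℝ} (hρ₀ : 0 < ρ) (hρ₁ : ρ < 1) (ht : 0 < t) {K : ℕ}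
    (h : ∀ k, K ≤ k → t ≤ u k → u (k + m) ≤ ρ * u k) :
    ∃ N, K ≤ N ∧ u N < t ∧
      (N : ℝ) ≤ K + m * (Real.posLog (u K / t) / Real.log (1 / ρ) + 1) := by
  have hl : 0 < Real.log (1 / ρ) := Real.log_pos (one_lt_one_div hρ₀ hρ₁)
  have hq : 0 ≤ Real.posLog (u K / t) / Real.log (1 / ρ) :=
    div_nonneg Real.posLog_nonneg hl.le
  set q := Real.posLog (u K / t) / Real.log (1 / ρ) with hqdef
  set j := ⌊q⌋₊ + 1 with hj
  refine ⟨K + j * m, by omega, ?_, ?_⟩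
  · by_contra! hc
    have h1 : ∀ i, i ≤ j → u (K + i * m) ≤ ρ ^ i * u K := by
      intro i
      induction i with
      | zero => simp
      | succ i ih =>
        intro hi
        have h2 : t ≤ u (K + i * m) := hc.trans (hu (by gcongr; omega))
        have h3 := h (K + i * m) (by omega) h2
        have h4 := ih (by omega)
        calc u (K + (i + 1) * m) = u (K + i * m + m) := by congr 1; ring
          _ ≤ ρ * u (K + i * m) := h3
          _ ≤ ρ * (ρ ^ i * u K) := by gcongr
          _ = _ := by ring
    have h2 : t ≤ ρ ^ j * u K := hc.trans (h1 j le_rfl)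
    have h3 : (1 / ρ) ^ j ≤ u K / t := by
      rw [one_div, inv_pow, le_div_iff₀ ht, inv_mul_le_iff₀ (by positivity)]
      exact h2
    have h4 : j * Real.log (1 / ρ) ≤ Real.posLog (u K / t) := by
      rw [← Real.log_pow]
      exact (Real.log_le_log (by positivity) h3).trans (le_max_right _ _)
    have h5 : (j : ℝ) ≤ q := by rwa [hqdef, le_div_iff₀ hl]
    have h6 := Nat.lt_floor_add_one q
    rw [hj] at h5
    push_cast at h5
    linarith
  · rw [hj]
    push_cast
    have := Nat.floor_le hq
    have hm : (0 : ℝ) ≤ m := Nat.cast_nonneg m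
    nlinarith

/-- The potential `log (ω / u)` grows by the factor `4 / 3` every `m` iterations. It starts above
`1` because `u N < ω / e`, so it exceeds `log (ω / ε)` after a doubly logarithmic number of rounds.
Arguing by contradiction keeps all gaps positive. -/
theorem superlinear_count (hu : Antitone u) {ω ε : ℝ} (hω : 0 < ω) (hε : 0 < ε) {K N : ℕ}
    (hKN : K ≤ N) (hN : u N < ω / Real.exp 1)
    (h : ∀ k, K ≤ k → u k < ω → 0 < u (k + m) →
      4 / 3 * Real.log (ω / u k) ≤ Real.log (ω / u (k + m))) :
    ∃ j : ℕ, u (N + j * m) ≤ ε ∧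
      (j : ℝ) ≤ Real.posLog (Real.log (ω / ε)) / Real.log (4 / 3) + 1 := by
  have hl : 0 < Real.log (4 / 3) := Real.log_pos (by norm_num)
  have hq : 0 ≤ Real.posLog (Real.log (ω / ε)) / Real.log (4 / 3) :=
    div_nonneg Real.posLog_nonneg hl.le
  set q := Real.posLog (Real.log (ω / ε)) / Real.log (4 / 3) with hqdef
  refine ⟨⌈q⌉₊, ?_, (Nat.ceil_lt_add_one hq).le⟩
  set j := ⌈q⌉₊
  by_contra! hc
  have hpos : ∀ i, i ≤ j → 0 < u (N + i * m) := fun i hi =>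
    hε.trans (hc.trans_le (hu (by gcongr)))
  have hlt : ∀ i, u (N + i * m) < ω := fun i =>
    (hu (by omega : N ≤ N + i * m)).trans_lt (hN.trans_le
      (div_le_self hω.le (Real.one_le_exp zero_le_one)))
  have h1 : ∀ i, i ≤ j → (4 / 3 : ℝ) ^ i ≤ Real.log (ω / u (N + i * m)) := by
    intro i
    induction i with
    | zero =>
      intro _
      have h0 : 0 < u N := by simpa using hpos 0 (Nat.zero_le _)
      rw [pow_zero, zero_mul, add_zero, Real.le_log_iff_exp_le (by positivity)]
      rw [lt_div_iff₀ (Real.exp_pos 1)] at hN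
      rw [le_div_iff₀ h0]
      linarith
    | succ i ih =>
      intro hi
      have h2 : N + (i + 1) * m = N + i * m + m := by ring
      have h3 := h (N + i * m) (by omega) (hlt i) (by rw [← h2]; exact hpos _ hi)
      have h4 := ih (by omega)
      rw [h2, pow_succ]
      linarith
  have h2 := h1 j le_rfl
  have h3 : Real.log (ω / u (N + j * m)) < Real.log (ω / ε) := by
    have := hpos j le_rfl
    apply Real.log_lt_log (by positivity)
    gcongr
  have h4 : (4 / 3 : ℝ) ^ j < Real.log (ω / ε) := h2.trans_lt h3
  have h5 : j * Real.log (4 / 3) < Real.log (Real.log (ω / ε)) := by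
    rw [← Real.log_pow]
    exact Real.log_lt_log (by positivity) h4
  have h6 : q ≤ j := Nat.le_ceil q
  rw [hqdef, div_le_iff₀ hl] at h6
  have h7 : Real.log (Real.log (ω / ε)) ≤ Real.posLog (Real.log (ω / ε)) := le_max_right _ _
  linarith

theorem sublinear_count {y : ℕ → ℝ} {c t : ℝ} (hc : 0 < c) (ht : 0 < t) (hy : ∀ j, 0 ≤ y j)
    (h : ∀ j : ℕ, y j * (1 + j * c * y 0) ≤ y 0) :
    ∃ j : ℕ, y j ≤ t ∧ (j : ℝ) ≤ 1 / c * (1 / t) + 1 := by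
  refine ⟨⌈1 / c * (1 / t)⌉₊, ?_, (Nat.ceil_lt_add_one (by positivity)).le⟩
  set j := ⌈1 / c * (1 / t)⌉₊
  by_contra! hlt
  have h1 := h j
  have h2 : 1 / c * (1 / t) ≤ j := Nat.le_ceil _
  rw [one_div_mul_one_div, div_le_iff₀ (by positivity)] at h2
  have h0 : 0 < y 0 := by
    rcases (hy 0).eq_or_lt with h0 | h0
    · rw [← h0] at h1
      simp at h1
      linarith
    · exact h0
  have h3 : 0 ≤ (j : ℝ) * c * y 0 := by positivity
  have h4 : t * (j * c * y 0) ≤ y j * (j * c * y 0) := by gcongr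
  have h5 : t * (j * c * y 0) = (j * (c * t)) * y 0 := by ring
  nlinarith

end Counting

/-! ### Inequalities valid in the regions. -/

section Regions

variable {n : ℕ} {f : E n → ℝ} {x₀ : E n} {κ fRef : ℝ} {y : E n}

theorem le_sq_of_mem_region12 (h : y ∈ region12 f x₀ κ fRef) :
    κ * (f y - fRef) ≤ ‖gradient f y‖ ^ 2 := by
  rw [← Real.rpow_two]
  exact h.2

theorem le_cube_of_mem_region23 (h : y ∈ region23 f x₀ κ fRef) :
    κ * (f y - fRef) ≤ negCurv f y ^ 3 := by
  have := h.2
  rwa [show (3 : ℝ) = (3 : ℕ) by norm_num, Real.rpow_natCast] at this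

theorem le_sq_of_mem_region22 (h : y ∈ region22 f x₀ κ fRef) :
    κ * (f y - fRef) ≤ negCurv f y ^ 2 := by
  rw [← Real.rpow_two]
  exact h.2

theorem le_of_mem_region1 (h : y ∈ region1 f x₀ κ fRef) (h1 : κ * (f y - fRef) < 1) :
    κ * (f y - fRef) ≤ ‖gradient f y‖ := by
  obtain ⟨-, τ, hτ, h2, -⟩ := h
  exact le_of_le_rpow_of_lt_one (norm_nonneg _) hτ.1 h2 h1

theorem le_of_mem_region2 (h : y ∈ region2 f x₀ κ fRef) (h1 : κ * (f y - fRef) < 1) :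
    κ * (f y - fRef) ≤ negCurv f y := by
  obtain ⟨-, τ, hτ, h2, -⟩ := h
  exact le_of_le_rpow_of_lt_one (negCurv_nonneg f y) hτ.1 h2 h1

theorem le_four_mul_of_mem_union (h : y ∈ region1 f x₀ κ fRef ∪ region2 f x₀ κ fRef)
    (h1 : 1 / 2 ≤ κ * (f y - fRef)) :
    κ * (f y - fRef) ≤ 4 * ‖gradient f y‖ ^ 2 ∨ κ * (f y - fRef) ≤ 4 * negCurv f y ^ 3 := by
  rcases h with ⟨-, τ, hτ, h2, -⟩ | ⟨-, τ, hτ, h2, -⟩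
  · exact Or.inl (le_four_mul_sq (norm_nonneg _) hτ h2 h1)
  · exact Or.inr (le_four_mul_cube (negCurv_nonneg f y) hτ h2 h1)

theorem region1_eq : region1 f x₀ κ fRef = region11 f x₀ κ fRef ∪ region12 f x₀ κ fRef := by
  rw [region11, sdiff_union_of_subset fun y hy => hy.1]

theorem region2_eq : region2 f x₀ κ fRef =
    region21 f x₀ κ fRef ∪ (region22 f x₀ κ fRef ∪ region23 f x₀ κ fRef) := by
  rw [region21, sdiff_union_of_subset]
  rintro y (hy | hy)
  · exact hy.1.1
  · exact hy.1

end Regions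

/-! ### The linear rate constant. -/

section Xi

variable {alg : Method} {κ ζ Δ₀ : ℝ}

theorem Method.gradExponent_eq (alg : Method) :
    alg.gradExponent = 2 ∨ alg.gradExponent = 3 / 2 := by
  cases alg <;> simp [Method.gradExponent]

theorem Method.le_xi (alg : Method) (κ ζ Δ₀ : ℝ) : 1 - κ / ζ ≤ alg.xi κ ζ Δ₀ := by
  cases alg <;> simp [Method.xi]

theorem Method.xi_pos (hκ : κ < ζ) (hζ : 0 < ζ) : 0 < alg.xi κ ζ Δ₀ := by
  refine lt_of_lt_of_le ?_ (alg.le_xi κ ζ Δ₀)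
  rw [sub_pos, div_lt_one hζ]
  exact hκ

theorem Method.xi_lt_one (hκ : 0 < κ) (hζ : 0 < ζ) (hΔ : 0 ≤ Δ₀) : alg.xi κ ζ Δ₀ < 1 := by
  have h1 : 1 - κ / ζ < 1 := by
    have : 0 < κ / ζ := by positivity
    linarith
  have h2 : Δ₀ ^ (1 / 4 : ℝ) / (κ ^ (3 / 4 : ℝ) / ζ + Δ₀ ^ (1 / 4 : ℝ)) < 1 := by
    have hk : 0 < κ ^ (3 / 4 : ℝ) / ζ := div_pos (Real.rpow_pos_of_pos hκ _) hζ
    have hd : 0 ≤ Δ₀ ^ (1 / 4 : ℝ) := Real.rpow_nonneg hΔ _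
    rw [div_lt_one (by positivity)]
    linarith
  cases alg
  · exact h1
  · exact max_lt h1 h2
  · exact max_lt h1 h2

/-- Monotonicity in the initial gap allows the rate at an upper bound `D` to serve all runs, which
makes the counting constants uniform. -/
theorem Method.xi_mono (hκ : 0 < κ) (hζ : 0 < ζ) (hΔ : 0 ≤ Δ₀) {D : ℝ} (hD : Δ₀ ≤ D) :
    alg.xi κ ζ Δ₀ ≤ alg.xi κ ζ D := by
  have hk : 0 < κ ^ (3 / 4 : ℝ) / ζ := div_pos (Real.rpow_pos_of_pos hκ _) hζ
  have hd : 0 ≤ Δ₀ ^ (1 / 4 : ℝ) := Real.rpow_nonneg hΔ _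
  have hle : Δ₀ ^ (1 / 4 : ℝ) ≤ D ^ (1 / 4 : ℝ) := by gcongr
  have h2 : Δ₀ ^ (1 / 4 : ℝ) / (κ ^ (3 / 4 : ℝ) / ζ + Δ₀ ^ (1 / 4 : ℝ)) ≤
      D ^ (1 / 4 : ℝ) / (κ ^ (3 / 4 : ℝ) / ζ + D ^ (1 / 4 : ℝ)) := by
    have hd' := hd.trans hle
    rw [div_le_div_iff₀ (by positivity) (by positivity)]
    nlinarith
  cases alg
  · exact le_rfl
  · exact max_le_max le_rfl h2
  · exact max_le_max le_rfl h2

end Xi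

/-! ### From progress and regions to decrease of the gap. -/

section Rates

variable {n : ℕ} {f : E n → ℝ} {x₀ : E n} {x : ℕ → E n} {ν : ℕ → ℝ} {θ Z νa νb : ℝ} {m : ℕ}

theorem Progress.gap_antitone (P : Progress f x₀ x ν θ Z νa νb m) :
    Antitone fun k => f (x k) - fInf f := fun _ _ h => sub_le_sub_right (P.anti h) _

theorem Progress.mono (P : Progress f x₀ x ν θ Z νa νb m) {Z' : ℝ} (hZ : Z ≤ Z') :
    Progress f x₀ x ν θ Z' νa νb m := by
  refine ⟨P.mem, P.anti, P.le_nu, P.nu_le, fun k => ?_⟩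
  obtain ⟨p, h1, h2, h3, h4⟩ := P.reduction k
  have h5 : Z * (f (x k) - f (x (k + m))) ≤ Z' * (f (x k) - f (x (k + m))) := by
    have := sub_nonneg.2 (P.anti (Nat.le_add_right k m))
    gcongr
  exact ⟨p, h1, h2, h3.trans h5, h4.trans h5⟩

variable {κ ζ : ℝ}

/-- A bound by `negCurv ^ 3`, or by `‖g‖ ^ 2` for TR-H, gives the recursion with power `1`. For the
cubic methods the gradient enters as `‖g‖ ^ (3 / 2) = (‖g‖ ^ 2) ^ (3 / 4)`, which gives power `3 /
4` and the second term of `ξ`. -/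
theorem Progress.linear {alg : Method} (P : Progress f x₀ x ν alg.gradExponent Z νa νb m)
    (hf : ∀ y, fInf f ≤ f y) (hκ : 0 < κ) (hZ : 0 < Z) (hζ : 4 * Z + κ ≤ ζ) {k : ℕ}
    (h : ∀ p, k ≤ p → p ≤ k + m → κ * (f (x p) - fInf f) ≤ 4 * ‖gradient f (x p)‖ ^ 2 ∨
      κ * (f (x p) - fInf f) ≤ 4 * negCurv f (x p) ^ 3) :
    f (x (k + m)) - fInf f ≤ alg.xi κ ζ (f (x 0) - fInf f) * (f (x k) - fInf f) := by
  obtain ⟨p, h1, h2, h3, h4⟩ := P.reduction k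
  have hb : 0 ≤ f (x k) - fInf f := sub_nonneg.2 (hf _)
  have ha : 0 ≤ f (x (k + m)) - fInf f := sub_nonneg.2 (hf _)
  have hab := P.gap_antitone (Nat.le_add_right k m)
  have haB := P.gap_antitone (Nat.zero_le (k + m))
  have hap := P.gap_antitone h2
  simp only at hab haB hap
  have hd : f (x k) - f (x (k + m)) = (f (x k) - fInf f) - (f (x (k + m)) - fInf f) := by ring
  rw [hd] at h3 h4
  set a := f (x (k + m)) - fInf f
  set b := f (x k) - fInf f
  set G := ‖gradient f (x p)‖
  have hκa : κ * a ≤ κ * (f (x p) - fInf f) := by gcongr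
  have hlin : κ * a ≤ 4 * Z * (b - a) → a ≤ alg.xi κ ζ (f (x 0) - fInf f) * b := fun h5 =>
    (le_one_sub_mul_of_implicit hκ hZ hζ hb h5).trans
      (by gcongr; exact alg.le_xi _ _ _)
  rcases h p h1 h2 with h5 | h5
  · have h34 : (κ * a) ^ (3 / 4 : ℝ) ≤ 4 * G ^ (3 / 2 : ℝ) := by
      calc (κ * a) ^ (3 / 4 : ℝ) ≤ (4 * G ^ 2) ^ (3 / 4 : ℝ) := by
            exact Real.rpow_le_rpow (by positivity) (hκa.trans h5) (by norm_num)
        _ = 4 ^ (3 / 4 : ℝ) * G ^ (3 / 2 : ℝ) := by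
            rw [Real.mul_rpow (by norm_num) (by positivity), sq_rpow_three_quarters (norm_nonneg _)]
        _ ≤ 4 * G ^ (3 / 2 : ℝ) := by
            gcongr
            calc (4 : ℝ) ^ (3 / 4 : ℝ) ≤ 4 ^ (1 : ℝ) :=
                  Real.rpow_le_rpow_of_exponent_le (by norm_num) (by norm_num)
              _ = 4 := Real.rpow_one 4
    have hthree : G ^ (3 / 2 : ℝ) ≤ Z * (b - a) →
        a ≤ (f (x 0) - fInf f) ^ (1 / 4 : ℝ) /
          (κ ^ (3 / 4 : ℝ) / ζ + (f (x 0) - fInf f) ^ (1 / 4 : ℝ)) * b := fun h6 =>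
      le_mul_of_implicit_three_quarters hκ hZ (by linarith) ha hab haB (by linarith)
    cases alg
    · simp only [Method.gradExponent, Real.rpow_two] at h3
      exact hlin (by linarith)
    · exact (hthree h3).trans (by gcongr; exact le_max_right _ _)
    · exact (hthree h3).trans (by gcongr; exact le_max_right _ _)
  · exact hlin (by linarith)

/-- As long as the gap is at least `1 / κ`, it decreases linearly. -/
theorem Progress.linear_initial {alg : Method} (P : Progress f x₀ x ν alg.gradExponent Z νa νb m)
    (hf : ∀ y, fInf f ≤ f y) (hκ : 0 < κ) (hZ : 0 < Z) (hζ : 4 * Z + κ ≤ ζ) (hζ2 : 2 * κ ≤ ζ)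
    (hreg : levelSet f x₀ = region1 f x₀ κ (fInf f) ∪ region2 f x₀ κ (fInf f)) {k : ℕ}
    (hk : 1 / κ ≤ f (x k) - fInf f) :
    f (x (k + m)) - fInf f ≤ alg.xi κ ζ (f (x 0) - fInf f) * (f (x k) - fInf f) := by
  -- Either the gap is halved, which is enough since `1 - κ / ζ ≥ 1 / 2`, or it satisfies `κ * Δ ≥ 1
  -- / 2` at all iterates in between.
  rcases le_or_gt (f (x (k + m)) - fInf f) (1 / 2 * (f (x k) - fInf f)) with h1 | h1
  · have hζ0 : 0 < ζ := by linarith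
    have h2 : 1 / 2 ≤ 1 - κ / ζ := by
      have : κ / ζ ≤ 1 / 2 := by
        rw [div_le_div_iff₀ hζ0 two_pos]
        linarith
      linarith
    have h3 : 1 / 2 ≤ alg.xi κ ζ (f (x 0) - fInf f) := h2.trans (alg.le_xi _ _ _)
    refine h1.trans ?_
    gcongr
    exact sub_nonneg.2 (hf _)
  · refine P.linear hf hκ hZ hζ fun p hp1 hp2 => ?_
    have hp := P.gap_antitone hp2
    simp only at hp
    refine le_four_mul_of_mem_union (hreg ▸ P.mem p) ?_
    rw [div_le_iff₀ hκ] at hk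
    nlinarith

theorem Progress.linear_of_region {alg : Method}
    (P : Progress f x₀ x ν alg.gradExponent Z νa νb m) (hf : ∀ y, fInf f ≤ f y) (hκ : 0 < κ)
    (hZ : 0 < Z) (hζ : 4 * Z + κ ≤ ζ) {K : ℕ}
    (h : ∀ k, K ≤ k → x k ∈ region12 f x₀ κ (fInf f) ∪ region23 f x₀ κ (fInf f)) {k : ℕ}
    (hk : K ≤ k) :
    f (x (k + m)) - fInf f ≤ alg.xi κ ζ (f (x 0) - fInf f) * (f (x k) - fInf f) := by
  refine P.linear hf hκ hZ hζ fun p hp1 _ => ?_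
  rcases h p (hk.trans hp1) with h1 | h1
  · left
    nlinarith [le_sq_of_mem_region12 h1, sq_nonneg ‖gradient f (x p)‖]
  · right
    nlinarith [le_cube_of_mem_region23 h1, pow_nonneg (negCurv_nonneg f (x p)) 3]

/-- Superlinear decrease in the gradient-dominated region of degree `2`. -/
theorem Progress.superlinear (P : Progress f x₀ x ν (3 / 2) Z νa νb m)
    (hκ : 0 < κ) (hZ : 0 < Z) (hζ : 4 * Z + κ ≤ ζ) {K : ℕ}
    (h : ∀ k, K ≤ k → x k ∈ region12 f x₀ κ (fInf f)) {k : ℕ} (hk : K ≤ k)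
    (hpos : 0 < f (x (k + m)) - fInf f) :
    4 / 3 * Real.log (κ ^ 3 / ζ ^ 4 / (f (x k) - fInf f)) ≤
      Real.log (κ ^ 3 / ζ ^ 4 / (f (x (k + m)) - fInf f)) := by
  obtain ⟨p, h1, h2, h3, -⟩ := P.reduction k
  have hab := P.gap_antitone (Nat.le_add_right k m)
  have hap := P.gap_antitone h2
  simp only at hab hap
  have hd : f (x k) - f (x (k + m)) = (f (x k) - fInf f) - (f (x (k + m)) - fInf f) := by ring
  have h4 := le_sq_of_mem_region12 (h p (hk.trans h1))
  rw [hd] at h3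
  set a := f (x (k + m)) - fInf f
  set b := f (x k) - fInf f
  have hb : 0 < b := hpos.trans_le hab
  have hζ0 : 0 < ζ := by linarith
  have h5 : (κ * a) ^ (3 / 4 : ℝ) ≤ ζ * b := by
    calc (κ * a) ^ (3 / 4 : ℝ) ≤ (‖gradient f (x p)‖ ^ 2) ^ (3 / 4 : ℝ) := by
          gcongr
          exact le_trans (by gcongr) h4
      _ = ‖gradient f (x p)‖ ^ (3 / 2 : ℝ) := sq_rpow_three_quarters (norm_nonneg _)
      _ ≤ Z * (b - a) := h3
      _ ≤ ζ * b := by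
        have : b - a ≤ b := by linarith
        gcongr
        linarith
  -- Up to the factor `4 / 3`, the logarithm of `(κ a) ^ (3 / 4) ≤ ζ b` is the claim: `ω = κ ^ 3 / ζ
  -- ^ 4` is the scale at which the constants cancel.
  have h6 := Real.log_le_log (by positivity) h5
  rw [Real.log_rpow (by positivity), Real.log_mul hκ.ne' hpos.ne',
    Real.log_mul hζ0.ne' hb.ne'] at h6
  have hω : Real.log (κ ^ 3 / ζ ^ 4) = 3 * Real.log κ - 4 * Real.log ζ := by
    rw [Real.log_div (by positivity) (by positivity), Real.log_pow, Real.log_pow]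
    norm_num
  rw [Real.log_div (by positivity) hb.ne', Real.log_div (by positivity) hpos.ne', hω]
  linarith

/-- The reduction dominates the power `q` of the scaled new gap if the optimality measures dominate
that power of the scaled gap at the iterates. -/
theorem Progress.implicit_reduction (P : Progress f x₀ x ν θ Z νa νb m)
    (hf : ∀ y, fInf f ≤ f y) (hκ : 0 < κ) {q : ℝ} (hq : 0 ≤ q) {k : ℕ}
    (h : ∀ p, k ≤ p → (κ * (f (x p) - fInf f)) ^ q ≤ ‖gradient f (x p)‖ ^ θ ∨
      (κ * (f (x p) - fInf f)) ^ q ≤ negCurv f (x p) ^ 3) :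
    (κ * (f (x (k + m)) - fInf f)) ^ q ≤
      Z * ((f (x k) - fInf f) - (f (x (k + m)) - fInf f)) := by
  obtain ⟨p, h1, h2, h3, h4⟩ := P.reduction k
  have hap := P.gap_antitone h2
  simp only at hap
  have ha : 0 ≤ f (x (k + m)) - fInf f := sub_nonneg.2 (hf _)
  have h5 : (κ * (f (x (k + m)) - fInf f)) ^ q ≤ (κ * (f (x p) - fInf f)) ^ q := by gcongr
  have hd : f (x k) - f (x (k + m)) = (f (x k) - fInf f) - (f (x (k + m)) - fInf f) := by ring
  rw [hd] at h3 h4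
  rcases h p h1 with h6 | h6 <;> linarith

variable {y : E n}

theorem rpow_le_of_mem_region22_23 (hu : 0 ≤ κ * (f y - fInf f))
    (hu1 : κ * (f y - fInf f) < 1) (h : y ∈ region22 f x₀ κ (fInf f) ∪ region23 f x₀ κ (fInf f)) :
    (κ * (f y - fInf f)) ^ (3 / 2 : ℝ) ≤ negCurv f y ^ 3 := by
  rcases h with h | h
  · have h1 := le_sq_of_mem_region22 h
    calc _ ≤ (negCurv f y ^ 2) ^ (3 / 2 : ℝ) := by gcongr
      _ = negCurv f y ^ 3 := by
        rw [← Real.rpow_natCast_mul (negCurv_nonneg f y), ← Real.rpow_natCast]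
        norm_num
  · have := Real.rpow_le_rpow_of_exponent_ge' hu hu1.le zero_le_one
      (show (1 : ℝ) ≤ 3 / 2 by norm_num)
    rw [Real.rpow_one] at this
    exact this.trans (le_cube_of_mem_region23 h)

theorem rpow_le_of_mem_region12_22_23 (hθ : θ = 2 ∨ θ = 3 / 2) (hu : 0 ≤ κ * (f y - fInf f))
    (hu1 : κ * (f y - fInf f) < 1) (h : y ∈ region12 f x₀ κ (fInf f) ∪
      (region22 f x₀ κ (fInf f) ∪ region23 f x₀ κ (fInf f))) :
    (κ * (f y - fInf f)) ^ (3 / 2 : ℝ) ≤ ‖gradient f y‖ ^ θ ∨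
      (κ * (f y - fInf f)) ^ (3 / 2 : ℝ) ≤ negCurv f y ^ 3 := by
  have hle : ∀ r : ℝ, 0 ≤ r → r ≤ 3 / 2 →
      (κ * (f y - fInf f)) ^ (3 / 2 : ℝ) ≤ (κ * (f y - fInf f)) ^ r := fun r h0 hr =>
    Real.rpow_le_rpow_of_exponent_ge' hu hu1.le h0 hr
  rcases h with h | h
  · left
    have h1 := le_sq_of_mem_region12 h
    rcases hθ with rfl | rfl
    · rw [Real.rpow_two]
      exact le_trans (by simpa using hle 1 zero_le_one (by norm_num)) h1
    · rw [← sq_rpow_three_quarters (norm_nonneg _)]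
      exact (hle (3 / 4) (by norm_num) (by norm_num)).trans (by gcongr)
  · exact Or.inr (rpow_le_of_mem_region22_23 hu hu1 h)

/-- In `R₁¹` only `κ * Δ ≤ ‖g‖` is available, so the power is the exponent `θ` of the method. This
is why TR-H and the cubic methods differ in case (c). -/
theorem rpow_le_of_mem_region1_22_23 (hθ : θ = 2 ∨ θ = 3 / 2) (hu : 0 ≤ κ * (f y - fInf f))
    (hu1 : κ * (f y - fInf f) < 1)
    (h : y ∈ region11 f x₀ κ (fInf f) ∪ region12 f x₀ κ (fInf f) ∪
      (region22 f x₀ κ (fInf f) ∪ region23 f x₀ κ (fInf f))) :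
    (κ * (f y - fInf f)) ^ θ ≤ ‖gradient f y‖ ^ θ ∨
      (κ * (f y - fInf f)) ^ θ ≤ negCurv f y ^ 3 := by
  rcases h with h | h
  · left
    have h1 := le_of_mem_region1 (region1_eq ▸ h) hu1
    have : 0 ≤ θ := by rcases hθ with rfl | rfl <;> norm_num
    gcongr
  · right
    refine le_trans (Real.rpow_le_rpow_of_exponent_ge' hu hu1.le (by norm_num) ?_)
      (rpow_le_of_mem_region22_23 hu hu1 h)
    rcases hθ with rfl | rfl <;> norm_num

/-- In `R₂¹` only `κ * Δ ≤ negCurv` is available, which forces the power `3`. Since `κ * Δ < 1`,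
this weakest power is valid in all regions. -/
theorem cube_le_of_mem (hθ : θ = 2 ∨ θ = 3 / 2) (hu : 0 ≤ κ * (f y - fInf f))
    (hu1 : κ * (f y - fInf f) < 1)
    (h : y ∈ region1 f x₀ κ (fInf f) ∪ region2 f x₀ κ (fInf f)) :
    (κ * (f y - fInf f)) ^ (3 : ℝ) ≤ ‖gradient f y‖ ^ θ ∨
      (κ * (f y - fInf f)) ^ (3 : ℝ) ≤ negCurv f y ^ 3 := by
  rcases h with h | h
  · left
    have h1 := le_of_mem_region1 h hu1
    have h0 : 0 ≤ θ := by rcases hθ with rfl | rfl <;> norm_num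
    have h3 : θ ≤ 3 := by rcases hθ with rfl | rfl <;> norm_num
    exact (Real.rpow_le_rpow_of_exponent_ge' hu hu1.le h0 h3).trans (by gcongr)
  · right
    have h1 := le_of_mem_region2 h hu1
    rw [show (3 : ℝ) = (3 : ℕ) by norm_num, Real.rpow_natCast]
    gcongr

end Rates

/-! ### Sublinear rates. -/

section SublinearRates

variable {u : ℕ → ℝ} {κ Z ζ : ℝ} {K m : ℕ}

theorem two_sub_one_div_mem : 0 < (√2 - 1) / √2 ∧ (√2 - 1) / √2 ≤ 1 := by
  have h : 1 < √2 := by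
    rw [Real.lt_sqrt] <;> norm_num
  constructor
  · have : 0 < √2 - 1 := by linarith
    positivity
  · rw [div_le_one (by positivity)]
    linarith

theorem div_le_div_ten {A Z ζ : ℝ} (hA : 0 ≤ A) (hZ : 0 < Z) (hζ : 10 * Z ≤ ζ) :
    A / ζ ≤ A / Z / 10 := by
  rw [div_div]
  gcongr
  linarith

theorem sublinear_rate_half (hu : ∀ k, 0 ≤ u k) (hκ : 0 < κ) (hκZ : κ ≤ Z) (hζ : 10 * Z ≤ ζ)
    (h1 : ∀ k, K ≤ k → κ * u k < 1)
    (h : ∀ k, K ≤ k → (κ * u (k + m)) ^ (3 / 2 : ℝ) ≤ Z * (u k - u (k + m))) (j : ℕ) :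
    √(u (K + j * m)) * (1 + j * (κ ^ (3 / 2 : ℝ) / ζ * ((√2 - 1) / √2)) * √(u K)) ≤ √(u K) := by
  have hZ : 0 < Z := by linarith
  have hζ0 : 0 < ζ := by linarith
  obtain ⟨hσ0, hσ1⟩ := two_sub_one_div_mem
  have hp : 0 < κ ^ (3 / 2 : ℝ) := Real.rpow_pos_of_pos hκ _
  have := sublinear_iterate (y := fun j => √(u (K + j * m)))
    (c := κ ^ (3 / 2 : ℝ) / ζ * ((√2 - 1) / √2)) (fun j => Real.sqrt_nonneg _) (fun j => ?_) j
  · simpa using this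
  · have hKj : K ≤ K + j * m := by omega
    have h2 := h _ hKj
    have h3 := h1 _ hKj
    have hidx : K + (j + 1) * m = K + j * m + m := by ring
    simp only [hidx]
    set a := u (K + j * m + m)
    set b := u (K + j * m)
    have ha : 0 ≤ a := hu _
    have hb : 0 ≤ b := hu _
    refine sublinear_step_half (e := κ ^ (3 / 2 : ℝ) / Z) (Real.sqrt_nonneg _)
      (Real.sqrt_nonneg _) (by positivity) (by positivity) ?_ ?_ ?_
    · refine le_trans ?_ (div_le_div_ten hp.le hZ hζ)
      exact mul_le_of_le_one_right (by positivity) hσ1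
    -- The normalization `e * β ≤ 1` follows from `κ * b < 1` and `κ ≤ Z`.
    · rw [div_mul_eq_mul_div, div_le_one hZ, rpow_three_halves hκ.le]
      have h4 : √κ * √b ≤ 1 := by
        rw [← Real.sqrt_mul hκ.le]
        exact Real.sqrt_le_one.2 h3.le
      calc √κ ^ 3 * √b = √κ ^ 2 * (√κ * √b) := by ring
        _ ≤ √κ ^ 2 * 1 := by gcongr
        _ = κ := by rw [Real.sq_sqrt hκ.le, mul_one]
        _ ≤ Z := hκZ
    · rw [div_mul_eq_mul_div, div_le_iff₀ hZ, Real.sq_sqrt ha, Real.sq_sqrt hb,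
        ← rpow_three_halves ha, ← Real.mul_rpow hκ.le ha]
      linarith

theorem sublinear_rate_one (hu : ∀ k, 0 ≤ u k) (hκ : 0 < κ) (hκZ : κ ≤ Z) (hζ : 10 * Z ≤ ζ)
    (h1 : ∀ k, K ≤ k → κ * u k < 1)
    (h : ∀ k, K ≤ k → (κ * u (k + m)) ^ (2 : ℝ) ≤ Z * (u k - u (k + m))) (j : ℕ) :
    u (K + j * m) * (1 + j * (κ ^ 2 / ζ) * u K) ≤ u K := by
  have hZ : 0 < Z := by linarith
  have hζ0 : 0 < ζ := by linarith
  have := sublinear_iterate (y := fun j => u (K + j * m)) (c := κ ^ 2 / ζ) (fun j => hu _)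
    (fun j => ?_) j
  · simpa using this
  · have hKj : K ≤ K + j * m := by omega
    have h2 := h _ hKj
    have h3 := h1 _ hKj
    have hidx : K + (j + 1) * m = K + j * m + m := by ring
    simp only [hidx]
    rw [Real.rpow_two] at h2
    refine sublinear_step_one (e := κ ^ 2 / Z) (hu _) (hu _) (by positivity) (by positivity)
      (div_le_div_ten (by positivity) hZ hζ) ?_ ?_
    · rw [div_mul_eq_mul_div, div_le_one hZ]
      nlinarith
    · rw [div_mul_eq_mul_div, div_le_iff₀ hZ]
      linarith

theorem sublinear_rate_two (hu : ∀ k, 0 ≤ u k) (hκ : 0 < κ) (hκZ : κ ≤ Z) (hζ : 10 * Z ≤ ζ)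
    (h1 : ∀ k, K ≤ k → κ * u k < 1)
    (h : ∀ k, K ≤ k → (κ * u (k + m)) ^ (3 : ℝ) ≤ Z * (u k - u (k + m))) (j : ℕ) :
    u (K + j * m) ^ 2 * (1 + j * (κ ^ 3 / ζ) * u K ^ 2) ≤ u K ^ 2 := by
  have hZ : 0 < Z := by linarith
  have hζ0 : 0 < ζ := by linarith
  have := sublinear_iterate (y := fun j => u (K + j * m) ^ 2) (c := κ ^ 3 / ζ)
    (fun j => sq_nonneg _) (fun j => ?_) j
  · simpa using this
  · have hKj : K ≤ K + j * m := by omega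
    have h2 := h _ hKj
    have h3 := h1 _ hKj
    have hidx : K + (j + 1) * m = K + j * m + m := by ring
    simp only [hidx]
    rw [show (3 : ℝ) = (3 : ℕ) by norm_num, Real.rpow_natCast] at h2
    refine sublinear_step_two (e := κ ^ 3 / Z) (hu _) (hu _) (by positivity) (by positivity)
      (div_le_div_ten (by positivity) hZ hζ) ?_ ?_
    · rw [div_mul_eq_mul_div, div_le_one hZ]
      have h4 : (κ * u (K + j * m)) ^ 2 ≤ 1 := pow_le_one₀ (mul_nonneg hκ.le (hu _)) h3.le
      calc κ ^ 3 * u (K + j * m) ^ 2 = κ * (κ * u (K + j * m)) ^ 2 := by ring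
        _ ≤ κ * 1 := by gcongr
        _ ≤ Z := by linarith
    · rw [div_mul_eq_mul_div, div_le_iff₀ hZ]
      linarith

theorem le_sq_mul_of_sqrt_mul_le {a b d : ℝ} (ha : 0 ≤ a) (hb : 0 ≤ b) (hd : 0 < d)
    (h : √a * d ≤ √b) : a ≤ (1 / d) ^ 2 * b := by
  rw [← le_div_iff₀ hd] at h
  calc a = √a ^ 2 := (Real.sq_sqrt ha).symm
    _ ≤ (√b / d) ^ 2 := by gcongr
    _ = _ := by rw [div_pow, Real.sq_sqrt hb]; ring

theorem le_sqrt_mul_of_sq_mul_le {a b d : ℝ} (ha : 0 ≤ a) (hb : 0 ≤ b) (hd : 0 < d)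
    (h : a ^ 2 * d ≤ b ^ 2) : a ≤ √(1 / d) * b := by
  rw [← le_div_iff₀ hd] at h
  calc a = √(a ^ 2) := (Real.sqrt_sq ha).symm
    _ ≤ √(1 / d * b ^ 2) := by
      gcongr
      rwa [one_div_mul_eq_div]
    _ = _ := by rw [Real.sqrt_mul (by positivity), Real.sqrt_sq hb]

end SublinearRates

/-! ### Cardinality of the set of iterations with a large gap. -/

section Cardinality

variable {n : ℕ} {f : E n → ℝ} {x : ℕ → E n} {ε : ℝ}

theorem cardLE_of_le (hu : Antitone fun k => f (x k) - fInf f) {N : ℕ}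
    (hN : f (x N) - fInf f ≤ ε) {b : ℝ} (hb : (N : ℝ) ≤ b) : CardLE f x ε b := by
  have hsub : Kf f x ε ⊆ (Finset.range N : Set ℕ) := by
    intro k hk
    have hk' : ε < f (x k) - fInf f := hk
    rw [Finset.coe_range]
    by_contra hc
    have := hu (not_lt.1 hc)
    simp only at this
    linarith
  refine ⟨(Finset.finite_toSet _).subset hsub, le_trans ?_ hb⟩
  have := Set.ncard_le_ncard hsub (Finset.finite_toSet _)
  rw [Set.ncard_coe_finset, Finset.card_range] at this
  exact_mod_cast this

theorem cardLE_of_sublinear (hu : Antitone fun k => f (x k) - fInf f) {y : ℕ → ℝ} {c t b : ℝ}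
    {K m : ℕ} (hc : 0 < c) (ht : 0 < t) (hy : ∀ j, 0 ≤ y j)
    (h : ∀ j : ℕ, y j * (1 + j * c * y 0) ≤ y 0)
    (hyt : ∀ j, y j ≤ t → f (x (K + j * m)) - fInf f ≤ ε)
    (hb : K + m * (1 / c * (1 / t) + 1) ≤ b) : CardLE f x ε b := by
  obtain ⟨j, h1, h2⟩ := sublinear_count hc ht hy h
  refine cardLE_of_le hu (hyt j h1) (le_trans ?_ hb)
  push_cast
  have hm : (0 : ℝ) ≤ m := Nat.cast_nonneg m
  nlinarith

end Cardinality

/-! ### Local quadratic convergence. -/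

section Local

variable {n : ℕ} {f : E n → ℝ} {x₀ xs y s : E n} {Lp : Set (E n)} {L₁ L₂ M₁ M₂ r : ℝ}

theorem StandingAssumptions.exists_ball (h : StandingAssumptions f x₀ Lp L₁ L₂ M₁ M₂)
    (hxs : xs ∈ Lp) (hl : 0 < leftEig (hess f xs)) :
    ∃ r, 0 < r ∧ Metric.ball xs r ⊆ Lp ∧ L₂ * r ≤ leftEig (hess f xs) / 2 := by
  obtain ⟨r, hr, hsub⟩ := Metric.isOpen_iff.1 h.isOpen xs hxs
  have hL₂ := h.L₂_pos
  refine ⟨min r (leftEig (hess f xs) / 2 / L₂), lt_min hr (by positivity),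
    (Metric.ball_subset_ball (min_le_left _ _)).trans hsub, ?_⟩
  rw [mul_comm, ← le_div_iff₀ hL₂]
  exact min_le_right _ _

theorem StandingAssumptions.coercive (h : StandingAssumptions f x₀ Lp L₁ L₂ M₁ M₂)
    (hxs : xs ∈ Lp) (hy : y ∈ Lp) (v : E n) :
    (leftEig (hess f xs) - L₂ * ‖y - xs‖) * ‖v‖ ^ 2 ≤ ⟪v, hess f y v⟫ := by
  have h1 := leftEig_mul_le (isSymmetric_hess h.smooth xs) v
  have h2 : |⟪v, (hess f y - hess f xs) v⟫| ≤ L₂ * ‖y - xs‖ * ‖v‖ ^ 2 := by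
    calc _ ≤ ‖v‖ * ‖(hess f y - hess f xs) v‖ := abs_real_inner_le_norm _ _
      _ ≤ ‖v‖ * (L₂ * ‖y - xs‖ * ‖v‖) := by
        gcongr
        exact ContinuousLinearMap.le_of_opNorm_le _ (h.hess_lipschitz y hy xs hxs) v
      _ = _ := by ring
  rw [sub_apply, inner_sub_right] at h2
  linarith [(abs_le.1 h2).1]

theorem StandingAssumptions.norm_gradient_le (h : StandingAssumptions f x₀ Lp L₁ L₂ M₁ M₂)
    (hxs : xs ∈ Lp) (hg : gradient f xs = 0) (hy : y ∈ Lp) :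
    ‖gradient f y‖ ≤ L₁ * ‖y - xs‖ := by
  simpa [hg] using h.grad_lipschitz y hy xs hxs

/-- The gradient at `y` is `hess f xs (y - xs)` up to a Taylor remainder. The first has norm at
least `l * ‖y - xs‖`, with `l` the smallest eigenvalue, and `hyr` lets it absorb the remainder. -/
theorem StandingAssumptions.norm_sub_le_gradient (h : StandingAssumptions f x₀ Lp L₁ L₂ M₁ M₂)
    (hxs : xs ∈ Lp) (hg : gradient f xs = 0) (hl : 0 < leftEig (hess f xs)) (hy : y ∈ Lp)
    (hyr : L₂ * ‖y - xs‖ ≤ leftEig (hess f xs) / 2) :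
    ‖y - xs‖ ≤ 2 / leftEig (hess f xs) * ‖gradient f y‖ := by
  set l := leftEig (hess f xs)
  set d := y - xs with hd
  have h1 : ‖gradient f y - hess f xs d‖ ≤ L₂ / 2 * ‖d‖ ^ 2 := by
    have := h.gradient_taylor (x := xs) (s := d) hxs (by simpa [hd] using hy)
    simpa [hg, hd] using this
  have h2 : l * ‖d‖ ≤ ‖hess f xs d‖ := by
    have h3 := leftEig_mul_le (isSymmetric_hess h.smooth xs) d
    have h4 := real_inner_le_norm d (hess f xs d)
    rcases (norm_nonneg d).eq_or_lt with h0 | h0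
    · rw [← h0]
      simp
    · refine le_of_mul_le_mul_left ?_ h0
      calc ‖d‖ * (l * ‖d‖) = l * ‖d‖ ^ 2 := by ring
        _ ≤ _ := h3.trans h4
  have h5 : ‖hess f xs d‖ ≤ ‖gradient f y‖ + ‖gradient f y - hess f xs d‖ :=
    norm_le_norm_add_norm_sub _ _
  rw [div_mul_eq_mul_div, le_div_iff₀ hl]
  nlinarith [norm_nonneg d, mul_nonneg hl.le (norm_nonneg d)]

/-- A step with a small residual of the Newton equation, from a point near a strict minimizer. -/
theorem StandingAssumptions.local_step (h : StandingAssumptions f x₀ Lp L₁ L₂ M₁ M₂)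
    (hxs : xs ∈ Lp) (hg : gradient f xs = 0) (hl : 0 < leftEig (hess f xs)) (hy : y ∈ Lp)
    (hys : y + s ∈ Lp) (hr : L₂ * ‖y + s - xs‖ ≤ leftEig (hess f xs) / 2) {c₁ c₂ : ℝ}
    (h1 : ‖s‖ ≤ c₁ * ‖y - xs‖) (h2 : ‖gradient f y + hess f y s‖ ≤ c₂ * ‖y - xs‖ ^ 2) :
    ‖y + s - xs‖ ≤ 2 / leftEig (hess f xs) * (L₂ / 2 * c₁ ^ 2 + c₂) * ‖y - xs‖ ^ 2 := by
  have hL₂ := h.L₂_pos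
  have h3 := h.gradient_taylor hy hys
  have h4 : ‖s‖ ^ 2 ≤ (c₁ * ‖y - xs‖) ^ 2 := by gcongr
  calc ‖y + s - xs‖ ≤ 2 / leftEig (hess f xs) * ‖gradient f (y + s)‖ :=
        h.norm_sub_le_gradient hxs hg hl hys hr
    _ = 2 / leftEig (hess f xs) * ‖(gradient f (y + s) - gradient f y - hess f y s) +
          (gradient f y + hess f y s)‖ := by congr 2; abel
    _ ≤ 2 / leftEig (hess f xs) * (L₂ / 2 * ‖s‖ ^ 2 + c₂ * ‖y - xs‖ ^ 2) := by
        gcongr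
        exact (norm_add_le _ _).trans (add_le_add h3 h2)
    _ ≤ 2 / leftEig (hess f xs) * (L₂ / 2 * (c₁ * ‖y - xs‖) ^ 2 + c₂ * ‖y - xs‖ ^ 2) := by gcongr
    _ = _ := by ring

/-- Near a strict minimizer, all steps of the cubically regularized model are accepted and
contract quadratically. -/
theorem StandingAssumptions.cubicStep_local (h : StandingAssumptions f x₀ Lp L₁ L₂ M₁ M₂)
    (hxs : xs ∈ Lp) (hg : gradient f xs = 0) (hl : 0 < leftEig (hess f xs)) {η : ℝ} (hη : η < 1)
    (νb : ℝ) : ∃ r c : ℝ, 0 < r ∧ ∀ (y s : E n) (ν : ℝ), 0 < ν → ν ≤ νb → ‖y - xs‖ < r →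
      IsCubicStep f ν y s →
      η * -cubicInc f ν y s ≤ f y - f (y + s) ∧ ‖y + s - xs‖ ≤ c * ‖y - xs‖ ^ 2 := by
  have hL₁ := h.L₁_pos
  have hL₂ := h.L₂_pos
  obtain ⟨r, hr, hball, hrL⟩ := h.exists_ball hxs hl
  set l := leftEig (hess f xs) with hldef
  set c₁ := 2 / l * L₁ with hc₁
  have hc₁0 : 0 < c₁ := by positivity
  have h1η : 0 < 1 - η := by linarith
  -- The first radius keeps `y + s` in the ball where the Hessian is coercive. The second makes the
  -- cubic Taylor error smaller than the fraction `1 - η` of the curvature term.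
  refine ⟨min (r / (1 + c₁)) ((1 - η) * l / (L₂ * c₁)),
    2 / l * (L₂ / 2 * c₁ ^ 2 + νb * c₁ ^ 2), lt_min (by positivity) (by positivity), ?_⟩
  intro y s ν hν hνb hyr hs
  have hy1 := hyr.trans_le (min_le_left _ _)
  have hy2 := hyr.trans_le (min_le_right _ _)
  rw [lt_div_iff₀ (by positivity)] at hy1 hy2
  set ρ := ‖y - xs‖ with hρ
  have hρ0 : 0 ≤ ρ := norm_nonneg _
  have hρr : ρ < r := by nlinarith
  have hy : y ∈ Lp := hball (by rwa [Metric.mem_ball, dist_eq_norm])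
  have hco : l / 2 * ‖s‖ ^ 2 ≤ ⟪s, hess f y s⟫ := by
    refine le_trans ?_ (h.coercive hxs hy s)
    gcongr
    have : L₂ * ρ ≤ L₂ * r := by gcongr
    rw [← hldef, ← hρ]
    linarith
  have heq := hs.inner_hess_eq
  have hs3 : 0 ≤ ν * ‖s‖ ^ 3 := by positivity
  have hgn := h.norm_gradient_le hxs hg hy
  have hsn : ‖s‖ ≤ c₁ * ρ := by
    have h1 := (abs_le.1 (abs_real_inner_le_norm (gradient f y) s)).1
    have h2 : l / 2 * ‖s‖ ^ 2 ≤ ‖gradient f y‖ * ‖s‖ := by linarith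
    have h3 : l / 2 * ‖s‖ ≤ ‖gradient f y‖ := by
      rcases (norm_nonneg s).eq_or_lt with h0 | h0
      · rw [← h0]
        simp
      · refine le_of_mul_le_mul_right ?_ h0
        calc l / 2 * ‖s‖ * ‖s‖ = l / 2 * ‖s‖ ^ 2 := by ring
          _ ≤ _ := h2
    rw [hc₁, mul_assoc, div_mul_eq_mul_div, le_div_iff₀ hl]
    linarith
  have hysr : ‖y + s - xs‖ < r := by
    calc ‖y + s - xs‖ = ‖(y - xs) + s‖ := by congr 1; abel
      _ ≤ ρ + c₁ * ρ := (norm_add_le _ _).trans (by gcongr)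
      _ < r := by linarith
  have hys : y + s ∈ Lp := hball (by rwa [Metric.mem_ball, dist_eq_norm])
  constructor
  · have h1 := (abs_le.1 (h.taylor_two hy hys)).2
    have h2 : -quadInc f y s = 1 / 2 * ⟪s, hess f y s⟫ + ν * ‖s‖ ^ 3 := by
      rw [quadInc]
      linarith
    have h3 : L₂ / 6 * ‖s‖ ^ 3 ≤ (1 - η) * (1 / 2 * ⟪s, hess f y s⟫) := by
      have h4 : L₂ * ‖s‖ ≤ (1 - η) * l := by
        calc L₂ * ‖s‖ ≤ L₂ * (c₁ * ρ) := by gcongr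
          _ ≤ _ := by linarith
      calc L₂ / 6 * ‖s‖ ^ 3 = L₂ * ‖s‖ * (1 / 6 * ‖s‖ ^ 2) := by ring
        _ ≤ (1 - η) * l * (1 / 6 * ‖s‖ ^ 2) := by gcongr
        _ ≤ (1 - η) * (1 / 2 * (l / 2 * ‖s‖ ^ 2)) := by
          have : 0 ≤ (1 - η) * l * ‖s‖ ^ 2 := by positivity
          linarith
        _ ≤ _ := by gcongr
    have h5 : cubicInc f ν y s = quadInc f y s + ν / 3 * ‖s‖ ^ 3 := rfl
    have h6 : 0 ≤ (1 - η) * (ν * ‖s‖ ^ 3) := by positivity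
    have h7 : 0 ≤ η * (ν / 3 * ‖s‖ ^ 3) + (1 - η) * (ν * ‖s‖ ^ 3) := by nlinarith
    nlinarith
  · refine h.local_step hxs hg hl hy hys (le_trans (by gcongr) hrL) hsn ?_
    calc ‖gradient f y + hess f y s‖ ≤ ν * ‖s‖ ^ 2 :=
          hs.norm_gradient_add_hess_le h.smooth hν.le
      _ ≤ νb * (c₁ * ρ) ^ 2 := by
          have : 0 < νb := hν.trans_le hνb
          gcongr
      _ = _ := by ring

/-- The Newton equation is solvable at a point where the Hessian is coercive. -/
theorem exists_newton_step {A : E n →L[ℝ] E n} {μ : ℝ} (hμ : 0 < μ)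
    (hA : ∀ v, μ * ‖v‖ ^ 2 ≤ ⟪v, A v⟫) (g : E n) : ∃ v, A v = -g := by
  have hinj : Function.Injective (A : E n →ₗ[ℝ] E n) := by
    rw [injective_iff_map_eq_zero]
    intro v hv
    have h1 := hA v
    have h2 : A v = 0 := hv
    rw [h2, inner_zero_right] at h1
    have h3 : ‖v‖ ^ 2 ≤ 0 := by
      by_contra! hc
      nlinarith
    exact norm_eq_zero.1 (pow_eq_zero_iff two_ne_zero |>.1 (le_antisymm h3 (sq_nonneg _)))
  exact (LinearMap.injective_iff_surjective.1 hinj) (-g)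

/-- The distance of a trust-region step from the Newton step, when the trust region contains the
Newton step scaled by `α`. -/
theorem IsTRStep.norm_sub_newton_le {δ μ α : ℝ} {v : E n} (hs : IsTRStep f δ y s)
    (hf : ContDiff ℝ 2 f) (hμ : 0 < μ) (hA : ∀ v, μ * ‖v‖ ^ 2 ≤ ⟪v, hess f y v⟫)
    (hv : hess f y v = -gradient f y) (hα₀ : 0 ≤ α) (hα₁ : α ≤ 1)
    (hδ : α * (‖gradient f y‖ / μ) ≤ δ) :
    ‖s - v‖ ≤ (1 - α) * (‖gradient f y‖ / μ) := by
  have hvn : ‖v‖ ≤ ‖gradient f y‖ / μ := by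
    rw [le_div_iff₀ hμ]
    have h1 := hA v
    have h2 := real_inner_le_norm v (hess f y v)
    rw [hv, norm_neg] at h2
    rw [hv] at h1
    rcases (norm_nonneg v).eq_or_lt with h0 | h0
    · rw [← h0]
      simp
    · nlinarith
  -- The scaled Newton step `α v` is feasible. Expanded about the minimizer `v` of the quadratic
  -- model, optimality of `s` says that `s - v` has at most the energy of `(α - 1) v`.
  have h1 := hs.2 (α • v) (by
    rw [norm_smul, Real.norm_of_nonneg hα₀]
    exact le_trans (by gcongr) hδ)
  have hq : ∀ d, quadInc f y (v + d) = quadInc f y v + 1 / 2 * ⟪d, hess f y d⟫ := fun d => by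
    rw [quadInc_add hf, hv, add_neg_cancel, inner_zero_left, add_zero]
  have h2 := hq (s - v)
  have h3 := hq ((α - 1) • v)
  rw [add_sub_cancel] at h2
  rw [show v + (α - 1) • v = α • v by module, map_smul, real_inner_smul_left,
    real_inner_smul_right, hv, inner_neg_right] at h3
  have h4 := (abs_le.1 (abs_real_inner_le_norm v (gradient f y))).1
  have h5 := hA (s - v)
  have h6 : μ * ‖s - v‖ ^ 2 ≤ (1 - α) ^ 2 * (‖v‖ * ‖gradient f y‖) := by
    have : (1 - α) ^ 2 * -⟪v, gradient f y⟫ ≤ (1 - α) ^ 2 * (‖v‖ * ‖gradient f y‖) := by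
      gcongr
      linarith
    nlinarith
  refine le_of_sq_le_sq ?_ (mul_nonneg (by linarith) (by positivity))
  have h7 : μ * ‖s - v‖ ^ 2 ≤ μ * ((1 - α) * (‖gradient f y‖ / μ)) ^ 2 := by
    calc μ * ‖s - v‖ ^ 2 ≤ (1 - α) ^ 2 * (‖gradient f y‖ / μ * ‖gradient f y‖) :=
          h6.trans (by gcongr)
      _ = _ := by field_simp
  exact le_of_mul_le_mul_left h7 hμ

/-- Near a strict minimizer, all trust-region steps are accepted and contract quadratically, if
the parameter `ν` does not exceed the smallest eigenvalue of the Hessian at the minimizer. -/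
theorem StandingAssumptions.trStep_local (h : StandingAssumptions f x₀ Lp L₁ L₂ M₁ M₂)
    (hxs : xs ∈ Lp) (hg : gradient f xs = 0) (hl : 0 < leftEig (hess f xs)) {η νa : ℝ}
    (hη₀ : 0 < η) (hη : η < 1) (hνa : 0 < νa) :
    ∃ r c : ℝ, 0 < r ∧ ∀ (y s : E n) (ν : ℝ), νa ≤ ν → ν ≤ leftEig (hess f xs) → ‖y - xs‖ < r →
      IsTRStep f (trHRadius f ν y) y s →
      η * -quadInc f y s ≤ f y - f (y + s) ∧ ‖y + s - xs‖ ≤ c * ‖y - xs‖ ^ 2 := by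
  have hL₁ := h.L₁_pos
  have hL₂ := h.L₂_pos
  obtain ⟨r, hr, hball, hrL⟩ := h.exists_ball hxs hl
  set l := leftEig (hess f xs) with hldef
  set c₁ := L₁ / νa with hc₁
  have hc₁0 : 0 < c₁ := by positivity
  have h1η : 0 < 1 - η := by linarith
  refine ⟨min (r / (1 + c₁)) ((1 - η) * νa ^ 3 / (L₂ * L₁ * (L₁ + l))),
    2 / l * (L₂ / 2 * c₁ ^ 2 + L₁ * (L₂ / l * (L₁ / (l / 2)))),
    lt_min (by positivity) (by positivity), ?_⟩
  intro y s ν hν hνl hyr hs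
  have hν0 : 0 < ν := hνa.trans_le hν
  have hy1 := hyr.trans_le (min_le_left _ _)
  have hy2 := hyr.trans_le (min_le_right _ _)
  rw [lt_div_iff₀ (by positivity)] at hy1 hy2
  set ρ := ‖y - xs‖ with hρ
  have hρ0 : 0 ≤ ρ := norm_nonneg _
  have hρr : ρ < r := by nlinarith
  have hy : y ∈ Lp := hball (by rwa [Metric.mem_ball, dist_eq_norm])
  have hL₂ρ : L₂ * ρ ≤ l / 2 := le_trans (by gcongr) hrL
  have hμ : 0 < l - L₂ * ρ := by linarith
  have hco : ∀ v, (l - L₂ * ρ) * ‖v‖ ^ 2 ≤ ⟪v, hess f y v⟫ := h.coercive hxs hy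
  -- The Hessian is positive definite here, so the radius is `‖g‖ / ν`.
  have hN : negCurv f y = 0 := by
    by_contra hc
    obtain ⟨v, hv, -, hv2⟩ :=
      exists_negCurv_direction h.smooth ((negCurv_nonneg f y).lt_of_ne' hc)
    have h1 := hco v
    rw [hv2, hv] at h1
    have := negCurv_nonneg f y
    linarith
  have hrad : trHRadius f ν y = 1 / ν * ‖gradient f y‖ := by
    have hc : negCurv f y ^ 3 ≤ ‖gradient f y‖ ^ 2 := by
      rw [hN, zero_pow three_ne_zero]
      positivity
    rw [trHRadius, if_pos hc]
  rw [hrad] at hs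
  have hgn : ‖gradient f y‖ ≤ L₁ * ρ := h.norm_gradient_le hxs hg hy
  have hsg : ‖s‖ ≤ 1 / νa * ‖gradient f y‖ := hs.1.trans (by gcongr)
  have hsn : ‖s‖ ≤ c₁ * ρ := by
    calc ‖s‖ ≤ 1 / νa * (L₁ * ρ) := hsg.trans (by gcongr)
      _ = _ := by rw [hc₁]; ring
  have hysr : ‖y + s - xs‖ < r := by
    calc ‖y + s - xs‖ = ‖(y - xs) + s‖ := by congr 1; abel
      _ ≤ ρ + c₁ * ρ := (norm_add_le _ _).trans (by gcongr)
      _ < r := by linarith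
  have hys : y + s ∈ Lp := hball (by rwa [Metric.mem_ball, dist_eq_norm])
  constructor
  · have h1 := (abs_le.1 (h.taylor_two hy hys)).2
    have h2 := hs.quadInc_le_gradient h hy (α := 1 / (L₁ + l)) (by positivity)
      (by rw [one_div_mul_eq_div, div_le_one (by positivity)]; linarith) (by
        gcongr
        linarith)
    have h3 : L₂ / 6 * ‖s‖ ^ 3 ≤ (1 - η) * -quadInc f y s := by
      have h4 : L₂ * ‖gradient f y‖ / νa ^ 3 ≤ (1 - η) / (L₁ + l) := by
        rw [div_le_div_iff₀ (by positivity) (by positivity)]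
        calc L₂ * ‖gradient f y‖ * (L₁ + l) ≤ L₂ * (L₁ * ρ) * (L₁ + l) := by gcongr
          _ ≤ _ := by linarith
      calc L₂ / 6 * ‖s‖ ^ 3 ≤ L₂ / 6 * (1 / νa * ‖gradient f y‖) ^ 3 := by gcongr
        _ = L₂ * ‖gradient f y‖ / νa ^ 3 * (1 / 6 * ‖gradient f y‖ ^ 2) := by field_simp
        _ ≤ (1 - η) / (L₁ + l) * (1 / 6 * ‖gradient f y‖ ^ 2) := by gcongr
        _ ≤ (1 - η) / (L₁ + l) * (1 / 2 * ‖gradient f y‖ ^ 2) := by gcongr; norm_num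
        _ = (1 - η) * (1 / (L₁ + l) / 2 * ‖gradient f y‖ ^ 2) := by ring
        _ ≤ _ := by gcongr; linarith
    linarith
  · obtain ⟨v, hv⟩ := exists_newton_step hμ hco (gradient f y)
    refine h.local_step hxs hg hl hy hys (le_trans (by gcongr) hrL) hsn ?_
    -- This `α` shrinks the bound for the Newton step to `‖g‖ / l`, which the radius covers because
    -- `ν ≤ l`. As `1 - α = L₂ ρ / l` is of order `ρ`, the residual is of order `ρ ^ 2`.
    have h1 := hs.norm_sub_newton_le h.smooth hμ hco hv (α := (l - L₂ * ρ) / l) (by positivity)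
      (by rw [div_le_one hl]; nlinarith) (by
        calc (l - L₂ * ρ) / l * (‖gradient f y‖ / (l - L₂ * ρ)) = 1 / l * ‖gradient f y‖ := by
              field_simp
          _ ≤ _ := by gcongr)
    have h2 : 1 - (l - L₂ * ρ) / l = L₂ * ρ / l := by field_simp; ring
    rw [h2] at h1
    calc ‖gradient f y + hess f y s‖ = ‖hess f y (s - v)‖ := by
          rw [map_sub, hv, sub_neg_eq_add, add_comm]
      _ ≤ L₁ * ‖s - v‖ := (hess f y).le_of_opNorm_le (h.norm_hess_le hy) _
      _ ≤ L₁ * (L₂ * ρ / l * (‖gradient f y‖ / (l - L₂ * ρ))) := by gcongr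
      _ ≤ L₁ * (L₂ * ρ / l * (L₁ * ρ / (l / 2))) := by
          gcongr
          linarith
      _ = _ := by ring

/-- Quadratic contraction near a cluster point implies quadratic convergence to it. -/
theorem convergesQuadratically_of_local {x : ℕ → E n} {r c : ℝ} (hr : 0 < r)
    (hloc : ∀ᶠ k in atTop, ‖x k - xs‖ < r → ‖x (k + 1) - xs‖ ≤ c * ‖x k - xs‖ ^ 2)
    (hsub : ∃ φ : ℕ → ℕ, StrictMono φ ∧ Tendsto (x ∘ φ) atTop (𝓝 xs)) :
    ConvergesQuadratically x xs := by
  obtain ⟨N, hN⟩ := eventually_atTop.1 hloc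
  obtain ⟨φ, hφ, hlim⟩ := hsub
  -- Within `r'` the quadratic bound contracts by `1 / 2`, so one late subsequence term inside this
  -- ball traps all later iterates.
  set r' := min r (1 / (2 * (|c| + 1))) with hr'
  have hr'0 : 0 < r' := lt_min hr (by positivity)
  have hstep : ∀ k, N ≤ k → ‖x k - xs‖ < r' → ‖x (k + 1) - xs‖ ≤ 1 / 2 * ‖x k - xs‖ := by
    intro k hk hx
    have h1 := hN k hk (hx.trans_le (min_le_left _ _))
    have h2 := hx.trans_le (min_le_right _ _)
    rw [lt_div_iff₀ (by positivity)] at h2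
    have h3 : c * ‖x k - xs‖ ≤ 1 / 2 := by
      nlinarith [le_abs_self c, norm_nonneg (x k - xs)]
    calc _ ≤ _ := h1
      _ = (c * ‖x k - xs‖) * ‖x k - xs‖ := by ring
      _ ≤ _ := by gcongr
  have hev : ∀ᶠ j in atTop, ‖x (φ j) - xs‖ < r' := by
    have : ∀ᶠ j in atTop, (x ∘ φ) j ∈ Metric.ball xs r' := hlim (Metric.ball_mem_nhds xs hr'0)
    filter_upwards [this] with j hj
    rwa [Function.comp_apply, mem_ball_iff_norm] at hj
  obtain ⟨j, hj1, hj2⟩ := (hev.and (eventually_ge_atTop N)).exists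
  have hK : N ≤ φ j := hj2.trans (hφ.id_le j)
  set K := φ j
  have hgeo : ∀ i, ‖x (i + K) - xs‖ ≤ (1 / 2) ^ i * ‖x K - xs‖ := by
    intro i
    induction i with
    | zero => simp
    | succ i ih =>
      have h1 : ‖x (i + K) - xs‖ < r' := by
        refine (ih.trans ?_).trans_lt hj1
        exact mul_le_of_le_one_left (norm_nonneg _) (pow_le_one₀ (by norm_num) (by norm_num))
      have h2 := hstep (i + K) (by omega) h1
      rw [show i + 1 + K = i + K + 1 by ring, pow_succ]
      linarith
  have hT : Tendsto x atTop (𝓝 xs) := by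
    rw [← tendsto_add_atTop_iff_nat K, tendsto_iff_norm_sub_tendsto_zero]
    refine squeeze_zero (fun i => norm_nonneg _) hgeo ?_
    have := (tendsto_pow_atTop_nhds_zero_of_lt_one (r := (1 / 2 : ℝ)) (by norm_num)
      (by norm_num)).mul_const ‖x K - xs‖
    simpa using this
  refine ⟨hT, c, ?_⟩
  have hev2 : ∀ᶠ k in atTop, ‖x k - xs‖ < r := by
    have : ∀ᶠ k in atTop, x k ∈ Metric.ball xs r := hT (Metric.ball_mem_nhds xs hr)
    filter_upwards [this] with k hk
    rwa [mem_ball_iff_norm] at hk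
  filter_upwards [hloc, hev2] with k h1 h2 using h1 h2

/-- The sublevel set is closed, so the limit lies in `Lp`. Near it all trial steps are taken, and
their contraction passes to the iterates. -/
theorem Method.convergesQuadratically (alg : Method) (halg : alg.Admissible L₂)
    (h : StandingAssumptions f x₀ Lp L₁ L₂ M₁ M₂) {x s : ℕ → E n} {ν : ℕ → ℝ}
    {θ Z νa νb : ℝ} {m : ℕ} (P : Progress f x₀ x ν θ Z νa νb m) (hνa : 0 < νa)
    (hrun : alg.IsRun f x s ν)
    (hsub : ∃ φ : ℕ → ℕ, StrictMono φ ∧ Tendsto (x ∘ φ) atTop (𝓝 xs))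
    (hg : gradient f xs = 0) (hl : 0 < leftEig (hess f xs))
    (hν : alg.IsTRH → ∀ᶠ k in atTop, ν k ≤ leftEig (hess f xs)) :
    ConvergesQuadratically x xs := by
  have hxs : xs ∈ Lp := by
    obtain ⟨φ, -, hlim⟩ := hsub
    have hcl : IsClosed (levelSet f x₀) := isClosed_le h.continuous continuous_const
    exact h.subset (hcl.mem_of_tendsto hlim (Eventually.of_forall fun j => P.mem _))
  have hνpos : ∀ k, 0 < ν k := fun k => hνa.trans_le (P.le_nu k)
  rcases alg with ⟨η, ψ, νmin, νmax⟩ | ⟨l₂⟩ | ⟨η, ψ, νmin, νmax⟩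
  · obtain ⟨hη₀, hη₁, -, -, -⟩ := halg
    obtain ⟨hstep, hup⟩ := hrun
    obtain ⟨r, c, hr, hloc⟩ := h.trStep_local hxs hg hl hη₀ hη₁ hνa
    refine convergesQuadratically_of_local (c := c) hr ?_ hsub
    filter_upwards [hν trivial] with k hk hxk
    obtain ⟨h1, h2⟩ := hloc _ _ _ (P.le_nu k) hk hxk (hstep k)
    rwa [((hup.2 k).1 h1).1]
  · have hrun' : ∀ k, ν k = l₂ ∧ IsCubicStep f l₂ (x k) (s k) ∧ x (k + 1) = x k + s k := hrun
    obtain ⟨r, c, hr, hloc⟩ := h.cubicStep_local hxs hg hl zero_lt_one l₂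
    refine convergesQuadratically_of_local (c := c) hr (Eventually.of_forall fun k hxk => ?_) hsub
    obtain ⟨h0, h1, h2⟩ := hrun' k
    rw [h2]
    exact (hloc _ _ _ (h0 ▸ hνpos k) le_rfl hxk h1).2
  · obtain ⟨hη₀, hη₁, -, -, -⟩ := halg
    obtain ⟨hstep, hup⟩ := hrun
    obtain ⟨r, c, hr, hloc⟩ := h.cubicStep_local hxs hg hl hη₁ νb
    refine convergesQuadratically_of_local (c := c) hr (Eventually.of_forall fun k hxk => ?_) hsub
    obtain ⟨h1, h2⟩ := hloc _ _ _ (hνpos k) (P.nu_le k) hxk (hstep k)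
    rwa [((hup.2 k).1 h1).1]

end Local

/-! ### Exhaustion of the sublevel set and of the cases. -/

section Regions

variable {n : ℕ} {f : E n → ℝ} {x₀ : E n} {κ : ℝ}

theorem levelSet_eq_of_isGHDominated (hf : ∀ y, fInf f ≤ f y) (hκ : 0 < κ)
    (hdom : IsGHDominated f x₀ κ 1 1) :
    levelSet f x₀ = region1 f x₀ κ (fInf f) ∪ region2 f x₀ κ (fInf f) := by
  refine Subset.antisymm (fun y hy => ?_) ?_
  · have h0 : 0 ≤ κ * (f y - fInf f) := mul_nonneg hκ.le (sub_nonneg.2 (hf y))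
    by_cases h1 : y ∈ region1 f x₀ κ (fInf f)
    · exact Or.inl h1
    · rcases le_max_iff.1 (hdom y hy) with h2 | h2
      · exact absurd ⟨hy, 1, by norm_num, h2, h0⟩ h1
      · exact Or.inr ⟨⟨hy, h1⟩, 1, by norm_num, h2, h0⟩
  · rintro y (hy | hy)
    · exact hy.1
    · exact hy.1.1

theorem exists_settlesAt {x : ℕ → E n} {S : Set (E n)} (h : ∀ᶠ k in atTop, x k ∈ S) (kbar : ℕ) :
    ∃ khat, SettlesAt x S kbar khat := by
  classical
  obtain ⟨N, hN⟩ := eventually_atTop.1 h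
  have hex : ∃ K, kbar ≤ K ∧ ∀ k, K ≤ k → x k ∈ S :=
    ⟨max kbar N, le_max_left _ _, fun k hk => hN k ((le_max_right _ _).trans hk)⟩
  exact ⟨_, Nat.isLeast_find hex⟩

theorem eventually_mem_of_not_frequently_mem_region21 {x : ℕ → E n} {fRef : ℝ}
    (hx : ∀ k, x k ∈ levelSet f x₀)
    (hreg : levelSet f x₀ = region1 f x₀ κ fRef ∪ region2 f x₀ κ fRef)
    (h : ¬∃ᶠ k in atTop, x k ∈ region21 f x₀ κ fRef) :
    ∀ᶠ k in atTop, x k ∈ region11 f x₀ κ fRef ∪ region12 f x₀ κ fRef ∪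
      (region22 f x₀ κ fRef ∪ region23 f x₀ κ fRef) := by
  filter_upwards [not_frequently.1 h] with k hk
  have hmem := hx k
  rw [hreg, region1_eq, region2_eq] at hmem
  rcases hmem with hmem | hmem | hmem
  · exact Or.inl hmem
  · exact absurd hmem hk
  · exact Or.inr hmem

end Regions

/-- The length of the initial phase and that of the sublinear phase, in a single bound. -/
theorem add_count_le {A m c t T κ C pl kbar : ℝ} (hκ : 0 < κ) (ht : 0 < t) (htT : t ≤ T)
    (hm : 0 ≤ m) (hpl : 0 ≤ pl) (hA : A ≤ C) (hC : κ * (2 * m * T + m * (1 / c)) ≤ C)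
    (hk : kbar ≤ A * pl + m) :
    kbar + m * (1 / c * (1 / t) + 1) ≤ C * pl + C * ((1 / κ) / t) := by
  have h1 : (2 * m * T + m * (1 / c)) / t ≤ C * ((1 / κ) / t) := by
    rw [show C * ((1 / κ) / t) = C / κ / t by ring]
    gcongr
    rw [le_div_iff₀ hκ]
    linarith
  -- The additive terms `m` of the two phases are absorbed into the last term by means of `t ≤ T`.
  have h2 : 2 * m ≤ 2 * m * T / t := by
    rw [le_div_iff₀ ht]
    gcongr
  have h3 : (2 * m * T + m * (1 / c)) / t = 2 * m * T / t + m * (1 / c * (1 / t)) := by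
    ring
  have h4 : A * pl ≤ C * pl := by gcongr
  linarith

end RegionalComplexity

/-! ### Choice of the constants and the four cases. -/

open RegionalComplexity in
theorem theorem4p2 (alg : Method) (L₁ L₂ : ℝ) (hL₁ : 0 < L₁) (hL₂ : 0 < L₂)
    (halg : alg.Admissible L₂) :
    -- the threshold for `ζ` and the number `m` depend only on `L₁`, `L₂` and the method
    ∃ ζ₀ : ℝ, ∃ m : ℕ, 0 < m ∧
    ∀ ζ : ℝ, ζ₀ ≤ ζ → max L₁ L₂ ≤ ζ → ∀ κ : ℝ, 0 < κ → κ ≤ min L₁ L₂ →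
    -- the constant `C` of the complexity bounds depends in addition only on `κ`, `ζ` and an
    -- upper bound `D` for the initial gap
    ∀ D : ℝ, ∃ C : ℝ, 0 < C ∧
    ∀ (n : ℕ) (f : E n → ℝ) (x₀ : E n) (Lp : Set (E n)) (M₁ M₂ : ℝ),
      StandingAssumptions f x₀ Lp L₁ L₂ M₁ M₂ →
      (IsGHDominated f x₀ κ 1 1 →
        levelSet f x₀ = region1 f x₀ κ (fInf f) ∪ region2 f x₀ κ (fInf f)) ∧
      (levelSet f x₀ = region1 f x₀ κ (fInf f) ∪ region2 f x₀ κ (fInf f) →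
        f x₀ - fInf f ≤ D →
        ∀ (x s : ℕ → E n) (ν : ℕ → ℝ), x 0 = x₀ → alg.IsRun f x s ν →
        let Δ : ℕ → ℝ := fun k => f (x k) - fInf f
        let ξ : ℝ := alg.xi κ ζ (Δ 0)
        let ω : ℝ := κ ^ 3 / ζ ^ 4
        let R11 : Set (E n) := region11 f x₀ κ (fInf f)
        let R12 : Set (E n) := region12 f x₀ κ (fInf f)
        let R21 : Set (E n) := region21 f x₀ κ (fInf f)
        let R22 : Set (E n) := region22 f x₀ κ (fInf f)
        let R23 : Set (E n) := region23 f x₀ κ (fInf f)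
        0 < ξ ∧ ξ < 1 ∧
        ∀ ε : ℝ, 0 < ε →
        ∃ kbar : ℕ, IsLeast {k : ℕ | Δ k < max (1 / κ) ε} kbar ∧
        -- initial linear phase
        (∀ k, k < kbar → Δ (k + m) ≤ ξ * Δ k) ∧
        (ε < 1 / κ →
          -- the cases are exhaustive: (c), which comprises (a) and (b), or (d)
          ((∃ khat, SettlesAt x (R11 ∪ R12 ∪ (R22 ∪ R23)) kbar khat) ∨
            (∃ᶠ k in atTop, x k ∈ R21)) ∧
          -- case (a)
          (∀ khat, SettlesAt x (R12 ∪ R23) kbar khat →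
            (∀ k, khat ≤ k → Δ (k + m) ≤ ξ * Δ k) ∧
            CardLE f x ε ((khat - kbar : ℝ) + C * (1 + Real.posLog (Δ 0 / ε))) ∧
            (¬ alg.IsTRH → ∀ K : ℕ, (∀ k, K ≤ k → x k ∈ R12) →
              (∀ᶠ k in atTop, Δ k < ω) ∧
              (∀ k, K ≤ k → Δ k < ω → 0 < Δ (k + m) →
                0 < 4 / 3 * Real.log (ω / Δ k) ∧
                4 / 3 * Real.log (ω / Δ k) ≤ Real.log (ω / Δ (k + m))) ∧
              (ε < ω → CardLE f x ε
                ((K : ℝ) + C * (1 + Real.posLog (Δ 0 / ω)) +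
                  C * (1 + Real.posLog (Real.log (ω / ε)))))) ∧
            (∀ xs : E n, (∃ φ : ℕ → ℕ, StrictMono φ ∧ Tendsto (x ∘ φ) atTop (𝓝 xs)) →
              gradient f xs = 0 → 0 < leftEig (hess f xs) →
              (alg.IsTRH → ∀ᶠ k in atTop, ν k ≤ leftEig (hess f xs)) →
              ConvergesQuadratically x xs)) ∧
          -- case (b)
          (∀ khat, SettlesAt x (R12 ∪ (R22 ∪ R23)) kbar khat →
            (∀ j : ℕ, Δ (khat + j * m) ≤
              (1 / (1 + j * (κ ^ (3 / 2 : ℝ) / ζ) * ((√2 - 1) / √2) * √(Δ khat))) ^ 2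
                * Δ khat) ∧
            CardLE f x ε ((khat - kbar : ℝ) + C * Real.posLog (Δ 0 / (1 / κ)) +
              C * ((1 / κ) / √ε))) ∧
          -- case (c)
          (∀ khat, SettlesAt x (R11 ∪ R12 ∪ (R22 ∪ R23)) kbar khat →
            (alg.IsTRH →
              (∀ j : ℕ, Δ (khat + j * m) ≤
                (1 / (1 + j * (κ ^ 2 / ζ) * Δ khat)) * Δ khat) ∧
              CardLE f x ε ((khat - kbar : ℝ) + C * Real.posLog (Δ 0 / (1 / κ)) +
                C * ((1 / κ) / ε))) ∧
            (¬ alg.IsTRH →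
              (∀ j : ℕ, Δ (khat + j * m) ≤
                (1 / (1 + j * (κ ^ (3 / 2 : ℝ) / ζ) * ((√2 - 1) / √2) * √(Δ khat))) ^ 2
                  * Δ khat) ∧
              CardLE f x ε ((khat - kbar : ℝ) + C * Real.posLog (Δ 0 / (1 / κ)) +
                C * ((1 / κ) / √ε)))) ∧
          -- case (d)
          ((∃ᶠ k in atTop, x k ∈ R21) →
            (∀ j : ℕ, Δ (kbar + j * m) ≤
              √(1 / (1 + j * (κ ^ 3 / ζ) * Δ kbar ^ 2)) * Δ kbar) ∧
            CardLE f x ε (C * Real.posLog (Δ 0 / (1 / κ)) + C * ((1 / κ) / ε ^ 2))))) := by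
  obtain ⟨Z₀, νa, νb, m, hZ₀, hνa, hm, hprog⟩ := alg.exists_progress hL₁ hL₂ halg
  -- The enlargement ensures `κ ≤ Z`, which the sublinear recursions need; the threshold `10 * Z`
  -- for `ζ` supplies their factor `1 / 10`.
  set Z := Z₀ + max L₁ L₂ with hZdef
  have hmaxL : 0 < max L₁ L₂ := lt_max_of_lt_left hL₁
  have hZ : 0 < Z := by positivity
  refine ⟨10 * Z, m, hm, fun ζ hζ _ κ hκ hκL D => ?_⟩
  have hκZ : κ ≤ Z := by
    have h1 : κ ≤ L₁ := hκL.trans (min_le_left _ _)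
    have h2 := le_max_left L₁ L₂
    linarith
  have hζ0 : 0 < ζ := by linarith
  -- The rate at `max D 0` bounds `ξ` for all admissible initial gaps and is defined before the run
  -- is chosen.
  have hρ0 : 0 < alg.xi κ ζ (max D 0) := Method.xi_pos (by linarith) hζ0
  have hρ1 : alg.xi κ ζ (max D 0) < 1 := Method.xi_lt_one hκ hζ0 (le_max_right _ _)
  set ρ := alg.xi κ ζ (max D 0) with hρ
  have hℓ : 0 < Real.log (1 / ρ) := Real.log_pos (one_lt_one_div hρ0 hρ1)
  set ℓ := Real.log (1 / ρ) with hℓdef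
  have hℓ' : 0 < Real.log (4 / 3) := Real.log_pos (by norm_num)
  have hmR : (0 : ℝ) < m := Nat.cast_pos.2 hm
  have hσ0 := two_sub_one_div_mem.1
  have hκp : 0 < κ ^ (3 / 2 : ℝ) := Real.rpow_pos_of_pos hκ _
  set cb := κ ^ (3 / 2 : ℝ) / ζ * ((√2 - 1) / √2) with hcb
  have hcb0 : 0 < cb := by positivity
  set cc := κ ^ 2 / ζ with hcc
  have hcc0 : 0 < cc := by positivity
  set cd := κ ^ 3 / ζ with hcd
  have hcd0 : 0 < cd := by positivity
  obtain ⟨C, hC0, hCA, hCm, hCl, hCb, hCc, hCd⟩ : ∃ C : ℝ, 0 < C ∧ 2 * (m / ℓ) ≤ C ∧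
      2 * (m / ℓ) + 2 * m ≤ C ∧ m / Real.log (4 / 3) + m ≤ C ∧
      κ * (2 * m * √(1 / κ) + m * (1 / cb)) ≤ C ∧ κ * (2 * m * (1 / κ) + m * (1 / cc)) ≤ C ∧
      κ * (2 * m * (1 / κ) ^ 2 + m * (1 / cd)) ≤ C := by
    have p1 : 0 < 2 * (m / ℓ) := by positivity
    have p2 : 0 < m / Real.log (4 / 3) := by positivity
    have p3 : 0 < κ * (2 * m * √(1 / κ) + m * (1 / cb)) := by positivity
    have p4 : 0 < κ * (2 * m * (1 / κ) + m * (1 / cc)) := by positivity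
    have p5 : 0 < κ * (2 * m * (1 / κ) ^ 2 + m * (1 / cd)) := by positivity
    exact ⟨2 * (m / ℓ) + 2 * m + m / Real.log (4 / 3) + κ * (2 * m * √(1 / κ) + m * (1 / cb)) +
      κ * (2 * m * (1 / κ) + m * (1 / cc)) + κ * (2 * m * (1 / κ) ^ 2 + m * (1 / cd)),
      by positivity, by linarith, by linarith, by linarith, by linarith, by linarith,
      by linarith⟩
  refine ⟨C, hC0, fun n f x₀ Lp M₁ M₂ h => ⟨levelSet_eq_of_isGHDominated h.fInf_le hκ, ?_⟩⟩
  intro hreg hD x s ν hx hrun Δ ξ ω R11 R12 R21 R22 R23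
  have hf := h.fInf_le
  have P : Progress f x₀ x ν alg.gradExponent Z νa νb m :=
    (hprog n f x₀ Lp M₁ M₂ h x s ν hx hrun).mono (by linarith)
  have hu : ∀ k, 0 ≤ Δ k := fun k => sub_nonneg.2 (hf _)
  have hanti : Antitone Δ := P.gap_antitone
  have hξ0 : 0 < ξ := Method.xi_pos (by linarith) hζ0
  have hξ1 : ξ < 1 := Method.xi_lt_one hκ hζ0 (hu 0)
  have hξρ : ξ ≤ ρ := Method.xi_mono hκ hζ0 (hu 0)
    (le_trans (by simpa [Δ, hx] using hD) (le_max_left D 0))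
  have hlin : ∀ k, 1 / κ ≤ Δ k → Δ (k + m) ≤ ξ * Δ k := fun k hk =>
    P.linear_initial hf hκ hZ (by linarith) (by linarith) hreg hk
  have hξρΔ : ∀ k, ξ * Δ k ≤ ρ * Δ k := fun k => mul_le_mul_of_nonneg_right hξρ (hu k)
  have hω : 0 < ω := by positivity
  obtain ⟨N₀, -, hN₀, hN₀le⟩ := linear_count hanti hρ0 hρ1 (one_div_pos.2 hκ) (K := 0)
    (fun k _ hk => (hlin k hk).trans (hξρΔ k))
  refine ⟨hξ0, hξ1, fun ε hε => ?_⟩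
  have hex : ∃ k, Δ k < max (1 / κ) ε := ⟨N₀, hN₀.trans_le (le_max_left _ _)⟩
  obtain ⟨kbar, hleast⟩ : ∃ k, IsLeast {k : ℕ | Δ k < max (1 / κ) ε} k :=
    ⟨_, Nat.isLeast_find hex⟩
  refine ⟨kbar, hleast, fun k hk => hlin k ?_, fun hεκ => ?_⟩
  · by_contra! hc
    exact absurd (hleast.2 (hc.trans_le (le_max_left _ _))) (not_le.2 hk)
  have hkbarN : kbar ≤ N₀ := hleast.2 (hN₀.trans_le (le_max_left _ _))
  set pl := Real.posLog (Δ 0 / (1 / κ)) with hpl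
  have hpl0 : 0 ≤ pl := Real.posLog_nonneg
  have hkbar : (kbar : ℝ) ≤ m / ℓ * pl + m := by
    have h1 : (kbar : ℝ) ≤ N₀ := by exact_mod_cast hkbarN
    have h2 : m * (pl / ℓ + 1) = m / ℓ * pl + m := by ring
    rw [Nat.cast_zero, zero_add] at hN₀le
    linarith
  have hsmall : ∀ k, kbar ≤ k → κ * Δ k < 1 := by
    intro k hk
    have h1 : Δ kbar < max (1 / κ) ε := hleast.1
    rw [max_eq_left hεκ.le, lt_div_iff₀ hκ] at h1
    have h2 : κ * Δ k ≤ κ * Δ kbar := mul_le_mul_of_nonneg_left (hanti hk) hκ.le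
    linarith
  have hκu : ∀ k, 0 ≤ κ * Δ k := fun k => mul_nonneg hκ.le (hu k)
  have hsqrt : √ε ≤ √(1 / κ) := Real.sqrt_le_sqrt hεκ.le
  have hCA' : m / ℓ ≤ C := by
    have : 0 < m / ℓ := by positivity
    linarith
  have half_case : ∀ khat, kbar ≤ khat →
      (∀ k, khat ≤ k → (κ * Δ k) ^ (3 / 2 : ℝ) ≤ ‖gradient f (x k)‖ ^ alg.gradExponent ∨
        (κ * Δ k) ^ (3 / 2 : ℝ) ≤ negCurv f (x k) ^ 3) →
      (∀ j : ℕ, Δ (khat + j * m) ≤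
        (1 / (1 + j * (κ ^ (3 / 2 : ℝ) / ζ) * ((√2 - 1) / √2) * √(Δ khat))) ^ 2 * Δ khat) ∧
      CardLE f x ε ((khat - kbar : ℝ) + C * pl + C * ((1 / κ) / √ε)) := by
    intro khat hkk hpow
    have hrate := sublinear_rate_half hu hκ hκZ hζ (K := khat) (m := m)
      (fun k hk => hsmall k (hkk.trans hk)) fun k hk =>
        P.implicit_reduction hf hκ (by norm_num) fun p hp => hpow p (hk.trans hp)
    constructor
    · intro j
      refine le_sq_mul_of_sqrt_mul_le (hu _) (hu _) (by positivity) ?_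
      rw [mul_assoc (j : ℝ)]
      exact hrate j
    · refine cardLE_of_sublinear hanti (y := fun j => √(Δ (khat + j * m))) (m := m) hcb0
        (Real.sqrt_pos.2 hε) (fun j => Real.sqrt_nonneg _) (fun j => by simpa using hrate j)
        (fun j hj => (Real.sqrt_le_sqrt_iff hε.le).1 hj) ?_
      have := add_count_le hκ (Real.sqrt_pos.2 hε) hsqrt hmR.le hpl0 hCA' hCb hkbar
      linarith
  have one_case : ∀ khat, kbar ≤ khat →
      (∀ k, khat ≤ k → (κ * Δ k) ^ (2 : ℝ) ≤ ‖gradient f (x k)‖ ^ alg.gradExponent ∨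
        (κ * Δ k) ^ (2 : ℝ) ≤ negCurv f (x k) ^ 3) →
      (∀ j : ℕ, Δ (khat + j * m) ≤ (1 / (1 + j * (κ ^ 2 / ζ) * Δ khat)) * Δ khat) ∧
      CardLE f x ε ((khat - kbar : ℝ) + C * pl + C * ((1 / κ) / ε)) := by
    intro khat hkk hpow
    have hrate := sublinear_rate_one hu hκ hκZ hζ (K := khat) (m := m)
      (fun k hk => hsmall k (hkk.trans hk)) fun k hk =>
        P.implicit_reduction hf hκ (by norm_num) fun p hp => hpow p (hk.trans hp)
    constructor
    · intro j
      have hd : 0 < 1 + j * (κ ^ 2 / ζ) * Δ khat := by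
        have := hu khat
        positivity
      rw [one_div_mul_eq_div, le_div_iff₀ hd]
      exact hrate j
    · refine cardLE_of_sublinear hanti (y := fun j => Δ (khat + j * m)) (m := m) hcc0
        hε (fun j => hu _) (fun j => by simpa using hrate j) (fun j hj => hj) ?_
      have := add_count_le hκ hε hεκ.le hmR.le hpl0 hCA' hCc hkbar
      linarith
  refine ⟨?_, ?_, ?_, ?_, ?_⟩
  · by_cases hfreq : ∃ᶠ k in atTop, x k ∈ R21
    · exact Or.inr hfreq
    · left
      exact exists_settlesAt (eventually_mem_of_not_frequently_mem_region21 P.mem hreg hfreq) kbar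
  · intro khat hset
    obtain ⟨hkk, hin⟩ := hset.1
    have hlina : ∀ k, khat ≤ k → Δ (k + m) ≤ ξ * Δ k := fun k hk =>
      P.linear_of_region hf hκ hZ (by linarith) hin hk
    refine ⟨hlina, ?_, ?_, ?_⟩
    · obtain ⟨N, -, hN, hNle⟩ := linear_count hanti hρ0 hρ1 hε
        (fun k hk _ => (hlina k hk).trans (hξρΔ k))
      -- The bound contains `khat - kbar`, so the count `kbar` of the initial phase must be paid for
      -- as well. This doubles the terms `m / ℓ` and `m`.
      refine cardLE_of_le hanti hN.le ?_
      have h1 : Real.posLog (Δ khat / ε) ≤ Real.posLog (Δ 0 / ε) := by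
        refine Real.posLog_le_posLog (div_nonneg (hu _) hε.le) ?_
        gcongr
        exact hanti (Nat.zero_le _)
      have h2 : pl ≤ Real.posLog (Δ 0 / ε) := by
        refine Real.posLog_le_posLog (div_nonneg (hu _) (by positivity)) ?_
        have := hu 0
        gcongr
      have hQ : 0 ≤ Real.posLog (Δ 0 / ε) := Real.posLog_nonneg
      set Q := Real.posLog (Δ 0 / ε)
      have h3 : m * (Real.posLog (Δ khat / ε) / ℓ + 1) ≤ m / ℓ * Q + m := by
        calc _ ≤ m * (Q / ℓ + 1) := by gcongr
          _ = _ := by ring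
      have h4 : m / ℓ * pl ≤ m / ℓ * Q := by gcongr
      have h5 : 2 * (m / ℓ) * Q + 2 * m ≤ C * (1 + Q) := by
        have : 2 * (m / ℓ) * Q ≤ C * Q := by gcongr
        have : 0 < m / ℓ := by positivity
        linarith
      linarith
    · intro hTR K hK
      have hθ : alg.gradExponent = 3 / 2 := by
        cases alg
        · exact absurd trivial hTR
        · rfl
        · rfl
      have hlinK : ∀ k, K ≤ k → Δ (k + m) ≤ ξ * Δ k := fun k hk =>
        P.linear_of_region hf hκ hZ (by linarith) (fun k hk => Or.inl (hK k hk)) hk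
      have hsup : ∀ k, K ≤ k → Δ k < ω → 0 < Δ (k + m) →
          4 / 3 * Real.log (ω / Δ k) ≤ Real.log (ω / Δ (k + m)) := fun k hk _ hpos =>
        (hθ ▸ P).superlinear hκ hZ (by linarith) hK hk hpos
      -- The linear phase is run down to `ω / e` so that `log (ω / Δ) ≥ 1` when the superlinear
      -- phase starts.
      have hωe : 0 < ω / Real.exp 1 := by positivity
      obtain ⟨N, hKN, hN, hNle⟩ := linear_count hanti hρ0 hρ1 hωe
        (fun k hk _ => (hlinK k hk).trans (hξρΔ k))
      have hNω : Δ N < ω := hN.trans_le (div_le_self hω.le (Real.one_le_exp zero_le_one))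
      refine ⟨?_, fun k hk hkω hpos => ⟨?_, hsup k hk hkω hpos⟩, fun hεω => ?_⟩
      · filter_upwards [eventually_ge_atTop N] with k hk
        exact (hanti hk).trans_lt hNω
      · have h0 : 0 < Δ k := hpos.trans_le (hanti (Nat.le_add_right k m))
        have := Real.log_pos ((one_lt_div h0).2 hkω)
        positivity
      · obtain ⟨j, hj, hjle⟩ := superlinear_count hanti hω hε hKN hN hsup
        refine cardLE_of_le hanti hj ?_
        have h1 : Real.posLog (Δ K / (ω / Real.exp 1)) ≤ Real.posLog (Δ 0 / ω) + 1 := by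
          calc Real.posLog (Δ K / (ω / Real.exp 1)) ≤ Real.posLog (Δ 0 / ω * Real.exp 1) := by
                refine Real.posLog_le_posLog (div_nonneg (hu _) hωe.le) ?_
                rw [div_div_eq_mul_div, div_mul_eq_mul_div]
                gcongr
                exact hanti (Nat.zero_le _)
            _ ≤ Real.posLog (Δ 0 / ω) + Real.posLog (Real.exp 1) := Real.posLog_mul
            _ = _ := by
              rw [Real.posLog_eq_log (x := Real.exp 1), Real.log_exp]
              rw [abs_of_pos (Real.exp_pos 1)]
              exact Real.one_le_exp zero_le_one
        have hQ : 0 ≤ Real.posLog (Δ 0 / ω) := Real.posLog_nonneg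
        have hQ' : 0 ≤ Real.posLog (Real.log (ω / ε)) := Real.posLog_nonneg
        set Q := Real.posLog (Δ 0 / ω)
        set Q' := Real.posLog (Real.log (ω / ε))
        have hmℓ : 0 < m / ℓ := by positivity
        have hmℓ' : 0 < m / Real.log (4 / 3) := by positivity
        have h2 : m * (Real.posLog (Δ K / (ω / Real.exp 1)) / ℓ + 1) ≤ C * (1 + Q) := by
          calc _ ≤ m * ((Q + 1) / ℓ + 1) := by gcongr
            _ = m / ℓ * Q + (m / ℓ + m) := by ring
            _ ≤ C * Q + C := by
              gcongr
              linarith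
            _ = _ := by ring
        have h3 : j * m ≤ C * (1 + Q') := by
          calc (j * m : ℝ) ≤ (Q' / Real.log (4 / 3) + 1) * m := by gcongr
            _ = m / Real.log (4 / 3) * Q' + m := by ring
            _ ≤ C * Q' + C := by
              gcongr
              · linarith
              · linarith
            _ = _ := by ring
        push_cast
        linarith
    · intro xs hsub hg hl hν
      exact alg.convergesQuadratically halg h P hνa hrun hsub hg hl hν
  · intro khat hset
    obtain ⟨hkk, hin⟩ := hset.1
    exact half_case khat hkk fun k hk => rpow_le_of_mem_region12_22_23 alg.gradExponent_eq
      (hκu k) (hsmall k (hkk.trans hk)) (hin k hk)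
  · intro khat hset
    obtain ⟨hkk, hin⟩ := hset.1
    have hpow : ∀ k, khat ≤ k → (κ * Δ k) ^ alg.gradExponent ≤
        ‖gradient f (x k)‖ ^ alg.gradExponent ∨
        (κ * Δ k) ^ alg.gradExponent ≤ negCurv f (x k) ^ 3 := fun k hk =>
      rpow_le_of_mem_region1_22_23 alg.gradExponent_eq (hκu k) (hsmall k (hkk.trans hk)) (hin k hk)
    constructor
    · intro hTR
      have hθ : alg.gradExponent = 2 := by
        cases alg
        · rfl
        · exact hTR.elim
        · exact hTR.elim
      refine one_case khat hkk fun k hk => ?_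
      have := hpow k hk
      rw [hθ] at this ⊢
      exact this
    · intro hTR
      have hθ : alg.gradExponent = 3 / 2 := by
        cases alg
        · exact absurd trivial hTR
        · rfl
        · rfl
      refine half_case khat hkk fun k hk => ?_
      have := hpow k hk
      rw [hθ] at this ⊢
      exact this
  · intro _
    have hrate := sublinear_rate_two hu hκ hκZ hζ (K := kbar) (m := m) hsmall fun k hk =>
      P.implicit_reduction hf hκ (by norm_num) fun p hp =>
        cube_le_of_mem alg.gradExponent_eq (hκu p) (hsmall p (hk.trans hp)) (hreg ▸ P.mem p)
    constructor
    · intro j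
      exact le_sqrt_mul_of_sq_mul_le (hu _) (hu _) (by positivity) (hrate j)
    · refine cardLE_of_sublinear hanti (y := fun j => Δ (kbar + j * m) ^ 2) (m := m) hcd0
        (pow_pos hε 2) (fun j => sq_nonneg _) (fun j => by simpa using hrate j)
        (fun j hj => le_of_sq_le_sq hj hε.le) ?_
      exact add_count_le hκ (pow_pos hε 2) (by gcongr) hmR.le hpl0 hCA' hCd hkbar
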